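/- Let $G$ be a second countable, locally compact (Hausdorff) unimodular group with Haar measure $\mu$, and let $\pi : G \to \mathcal{U}(\mathcal{H})$ be a projective unitary representation on a separable Hilbert space $\mathcal{H}$, i.e. a strongly measurable map with $\pi(x)\pi(y) = \sigma(x,y)\pi(xy)$ for some function $\sigma : G\times G \to \mathbb{T}$. Assume that $\pi$ is a discrete series representation: it is irreducible (the only closed $\pi(G)$-invariant subspaces are $\{0\}$ and $\mathcal{H}$), and $\int_G |\langle g_0, \pi(x) g_0\rangle|^2 \, d\mu(x) < \infty$ for some $g_0 \neq 0$. Let $d_\pi > 0$ be its formal degree, i.e. the unique number with \[ \int_G \langle f_1, \pi(x) g_1\rangle \langle \pi(x) g_2, f_2\rangle \, d\mu(x) = d_\pi^{-1} \langle f_1, f_2\rangle \overline{\langle g_1, g_2\rangle} \quad \text{for all } f_1,f_2,g_1,g_2 \in \mathcal{H}. \] For $g \in \mathcal{H}$ write $V_g g(x) = \langle g, \pi(x) g\rangle$; for a relatively compact symmetric unit neighborhood $Q \subseteq G$ write $M_Q F(x) = \sup_{z \in Q} |F(xz)|$; and let $\mathcal{D}_\pi$ be the set of all $g \in \mathcal{H}$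 with $M_Q V_g g \in L^2(G)$ for one (equivalently, every) such $Q$. A strong Følner exhaustion sequence in $G$ is a sequence $(K_n)_{n\in\mathbb{N}}$ of nonnull compact sets with $\mu(K_n K \cap K_n^c K)/\mu(K_n) \to 0$ for every compact $K \subseteq G$, with $e \in K_n \subseteq (K_{n+1})^\circ$ for all $n$, and with $\bigcup_n K_n = G$. For $\Lambda \subseteq G$, the family $\pi(\Lambda)g = (\pi(\lambda)g)_{\lambda\in\Lambda}$ is a Riesz sequence with Riesz bounds $A, B > 0$ if $A\|c\|^2 \le \big\|\sum_{\lambda\in\Lambda} c_\lambda \pi(\lambda) g\big\|^2 \le B\|c\|^2$ for all $c \in \ell^2(\Lambda)$ (the series being convergent). Theorem. Let $Q \subseteq G$ be a relatively compact symmetric unit neighborhood, let $g \in \mathcal{D}_\pi$, and let $A, B > 0$. There is a constant $C > 0$, depending (for given $G$, $\mu$ and $\pi$) only on $g$, $Q$, $A$ and $B$, such that for every $\Lambda \subseteq G$ for which $\pi(\Lambda) g$ is a Riesz sequence with Riesz bounds $A, B$, and for every strong Følner exhaustion sequence $(K_n)_{n \in \mathbb{N}}$ in $G$, \[ \sup_{x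 \in G} \#(\Lambda \cap xK_n) \le d_\pi\big(\mu(K_n) + C J_n\big) \quad \text{for all } n \in \mathbb{N}, \] where \[ J_n := \int_{K_n^c} \int_{K_n Q} |M_Q V_g g(y^{-1}z)|^2 \, d\mu(z)\, d\mu(y) < \infty \qquad\text{and}\qquad J_n = o(\mu(K_n)) \ \text{ as } n \to \infty. \] -/

import Mathlib

open MeasureTheory Filter Topology Set
open scoped Pointwise ENNReal ComplexConjugate

noncomputable section

namespace CoherentSystem

/-- `Q` is a relatively compact symmetric unit neighborhood. -/
structure IsSymmUnitNhd {G : Type*} [Group G] [TopologicalSpace G] (Q : Set G) : Prop where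
  mem_nhds : Q ∈ 𝓝 (1 : G)
  symm : Q⁻¹ = Q
  relCompact : IsCompact (closure Q)

/-- A (right) strong Følner sequence: nonnull compact sets `K n` with
`μ (K n * L ∩ (K n)ᶜ * L) / μ (K n) → 0` for all compact `L`. -/
structure IsStrongFolner {G : Type*} [Group G] [TopologicalSpace G] [MeasurableSpace G]
    (μ : Measure G) (K : ℕ → Set G) : Prop where
  isCompact : ∀ n, IsCompact (K n)
  nonnull : ∀ n, μ (K n) ≠ 0
  tendsto : ∀ L : Set G, IsCompact L →
    Tendsto (fun n => μ ((K n * L) ∩ ((K n)ᶜ * L)) / μ (K n)) atTop (𝓝 0)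

/-- A strong Følner exhaustion sequence. -/
structure IsStrongFolnerExhaustion {G : Type*} [Group G] [TopologicalSpace G]
    [MeasurableSpace G] (μ : Measure G) (K : ℕ → Set G) : Prop
    extends IsStrongFolner μ K where
  one_mem : ∀ n, (1 : G) ∈ K n
  subset_interior : ∀ n, K n ⊆ interior (K (n + 1))
  iUnion_eq : ⋃ n, K n = univ

/-- A projective unitary representation of `G` on `H`: a strongly measurable map into the unitary
operators, multiplicative up to a circle-valued cocycle. -/
structure ProjRep (G H : Type*) [Group G] [MeasurableSpace G] [NormedAddCommGroup H]
    [InnerProductSpace ℂ H] where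
  toFun : G → H ≃ₗᵢ[ℂ] H
  cocycle : G → G → Circle
  stronglyMeasurable : ∀ f : H, StronglyMeasurable fun x => toFun x f
  mul_apply : ∀ x y f, toFun x (toFun y f) = (cocycle x y : ℂ) • toFun (x * y) f

instance {G H : Type*} [Group G] [MeasurableSpace G] [NormedAddCommGroup H]
    [InnerProductSpace ℂ H] : CoeFun (ProjRep G H) (fun _ => G → H ≃ₗᵢ[ℂ] H) :=
  ⟨ProjRep.toFun⟩

section

variable {G H : Type*} [Group G] [MeasurableSpace G] [NormedAddCommGroup H]
  [InnerProductSpace ℂ H]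

/-- The coefficient transform `V_g f (x) = ⟨f, π(x) g⟩`, where the inner product `⟨·, ·⟩` is linear
in the first argument; Mathlib's `inner ℂ` is linear in the second one. -/
def coeff (π : ProjRep G H) (g f : H) (x : G) : ℂ := inner ℂ (π x g) f

/-- The only closed invariant subspaces are `{0}` and `H`. -/
def IsIrreducible (π : ProjRep G H) : Prop :=
  ∀ W : Submodule ℂ H, IsClosed (W : Set H) → (∀ x, ∀ f ∈ W, π x f ∈ W) → W = ⊥ ∨ W = ⊤

/-- A projective discrete series representation: irreducible and square-integrable. -/
structure IsDiscreteSeries (μ : Measure G) (π : ProjRep G H) : Prop where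
  irreducible : IsIrreducible π
  squareIntegrable : ∃ g : H, g ≠ 0 ∧ ∫⁻ x, ‖coeff π g g x‖ₑ ^ 2 ∂μ < ∞

/-- `d > 0` satisfies the orthogonality relations
`∫ ⟨f₁, π(x) g₁⟩ ⟨π(x) g₂, f₂⟩ dμ(x) = d⁻¹ ⟨f₁, f₂⟩ conj ⟨g₁, g₂⟩`
(inner products linear in the first argument). -/
def IsFormalDegree (μ : Measure G) (π : ProjRep G H) (d : ℝ) : Prop :=
  0 < d ∧ ∀ f₁ f₂ g₁ g₂ : H,
    Integrable (fun x => coeff π g₁ f₁ x * conj (coeff π g₂ f₂ x)) μ ∧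
    ∫ x, coeff π g₁ f₁ x * conj (coeff π g₂ f₂ x) ∂μ
      = (d : ℂ)⁻¹ * inner ℂ f₂ f₁ * conj (inner ℂ g₂ g₁)

open Classical in
/-- The formal degree `d_π`: the number `d > 0` for which the orthogonality relations hold
(`0` if there is none). -/
def formalDegree (μ : Measure G) (π : ProjRep G H) : ℝ :=
  if h : ∃ d, IsFormalDegree μ π d then h.choose else 0

/-- The local maximal function `M_Q F (x) = sup_{z ∈ Q} |F (x z)|`, with values in `[0, ∞]`. -/
def localMax (Q : Set G) (F : G → ℂ) (x : G) : ℝ≥0∞ := ⨆ z ∈ Q, ‖F (x * z)‖ₑ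

/-- The set `D_π` of vectors `g` with `M_U V_g g ∈ L²(G)` for some relatively compact symmetric unit
neighborhood `U`. The condition does not depend on `U`, and `M_U V_g g` is always measurable, being
a supremum of continuous functions. -/
def localized [TopologicalSpace G] (μ : Measure G) (π : ProjRep G H) : Set H :=
  {g | ∃ U : Set G, IsSymmUnitNhd U ∧ ∫⁻ x, localMax U (coeff π g g) x ^ 2 ∂μ < ∞}

/-- The family `(π(t) g)`, `t ∈ Λ`, is a Riesz sequence with Riesz bounds `A, B > 0`. -/
def IsRieszSeq (π : ProjRep G H) (Λ : Set G) (g : H) (A B : ℝ) : Prop :=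
  0 < A ∧ 0 < B ∧ ∀ c : lp (fun _ : Λ => ℂ) 2,
    Summable (fun t : Λ => c t • π (t : G) g) ∧
    A * ‖c‖ ^ 2 ≤ ‖∑' t : Λ, c t • π (t : G) g‖ ^ 2 ∧
    ‖∑' t : Λ, c t • π (t : G) g‖ ^ 2 ≤ B * ‖c‖ ^ 2

/-- `J = ∫_{Kᶜ} ∫_{K Q} |M_Q V_g g (y⁻¹ z)|² dμ(z) dμ(y)`. -/
def rieszError (μ : Measure G) (π : ProjRep G H) (g : H) (Q K : Set G) : ℝ≥0∞ :=
  ∫⁻ y in Kᶜ, ∫⁻ z in K * Q, localMax Q (coeff π g g) (y⁻¹ * z) ^ 2 ∂μ ∂μ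

end

end CoherentSystem

end

open CoherentSystem

/-!
For finite `F ⊆ Λ ∩ K` let `P` be the orthogonal projection onto the span of the `π(t) g`, `t ∈ F`.
The orthogonality relations give `d_π ∫ ‖P (π(y) g)‖² dμ(y) = dim (ran P) ‖g‖² = #F ‖g‖²`. On `K`
the integrand is at most `‖g‖²`; outside `K` the lower Riesz bound gives
`A ‖P (π(y) g)‖² ≤ ∑ |V_g g (y⁻¹ t)|²`, summed over `t ∈ F`. The same bound forces `Λ` to be
relatively separated, so the translates `t Q` overlap boundedly and the sum is at most a constant
times `∫ |M_Q V_g g (y⁻¹ z)|² dμ(z)` over `K Q`. The constant does not depend on `Λ`, because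
`x ↦ ⟨f, π(x) g⟩` is continuous in modulus by Steinhaus' theorem.

The formal degree exists by Schur's lemma, applied to the projection of the closed graph of
`f ↦ V_g f` to its domain. Fubini's theorem turns the error into
`∫ |M_Q V_g g (w)|² μ(Kᶜ ∩ (K Q) w⁻¹) dμ(w)`, so that dominated convergence applies.
-/

namespace CoherentSystem

section Basic

variable {G H : Type*} [Group G] [MeasurableSpace G] [NormedAddCommGroup H]
  [InnerProductSpace ℂ H]

theorem ProjRep.norm_inner_apply_apply (π : ProjRep G H) (x y : G) (a b : H) :
    ‖inner ℂ (π x a) (π y b)‖ = ‖inner ℂ a (π (x⁻¹ * y) b)‖ := by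
  have h := congrArg (inner ℂ (π x a)) (π.mul_apply x (x⁻¹ * y) b)
  rw [LinearIsometryEquiv.inner_map_map, mul_inv_cancel_left, inner_smul_right] at h
  rw [h, norm_mul, Circle.norm_coe, one_mul]

theorem ProjRep.one_apply (π : ProjRep G H) (f : H) : π 1 f = π.cocycle 1 1 • f := by
  have h := π.mul_apply 1 1 f
  rw [mul_one, ← map_smul] at h
  exact (π 1).injective h

theorem ProjRep.norm_inner_one_right (π : ProjRep G H) (a b : H) :
    ‖inner ℂ a (π 1 b)‖ = ‖inner ℂ a b‖ := by
  rw [π.one_apply, Circle.smul_def, inner_smul_right, norm_mul, Circle.norm_coe, one_mul]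

theorem norm_coeff_apply (π : ProjRep G H) (g f : H) (y x : G) :
    ‖coeff π g (π y f) x‖ = ‖coeff π g f (y⁻¹ * x)‖ := by
  rw [coeff, coeff, norm_inner_symm, π.norm_inner_apply_apply, norm_inner_symm]

theorem norm_coeff_apply_left (π : ProjRep G H) (g f : H) (y x : G) :
    ‖coeff π (π y g) f x‖ = ‖coeff π g f (x * y)‖ := by
  rw [coeff, π.mul_apply, inner_smul_left, norm_mul, RCLike.norm_conj, Circle.norm_coe, one_mul,
    coeff]

theorem norm_coeff_inv (π : ProjRep G H) (g f : H) (x : G) :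
    ‖coeff π g f x‖ = ‖coeff π f g x⁻¹‖ := by
  rw [coeff, coeff, ← π.norm_inner_one_right, π.norm_inner_apply_apply, mul_one, norm_inner_symm]

theorem norm_coeff_one (π : ProjRep G H) (g f : H) : ‖coeff π g f 1‖ = ‖inner ℂ g f‖ := by
  rw [coeff, norm_inner_symm, π.norm_inner_one_right, norm_inner_symm]

theorem norm_coeff_sub_left_le (π : ProjRep G H) (g h f : H) (x : G) :
    ‖coeff π g f x - coeff π h f x‖ ≤ ‖g - h‖ * ‖f‖ := by
  have := norm_inner_le_norm (𝕜 := ℂ) (π x (g - h)) f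
  rwa [map_sub, inner_sub_left, ← map_sub, LinearIsometryEquiv.norm_map] at this

theorem coeff_add (π : ProjRep G H) (g f h : H) : coeff π g (f + h) = coeff π g f + coeff π g h :=
  funext fun _ => inner_add_right _ _ _

theorem coeff_smul (π : ProjRep G H) (g : H) (a : ℂ) (f : H) :
    coeff π g (a • f) = a • coeff π g f :=
  funext fun _ => inner_smul_right _ _ _

theorem coeff_add_left (π : ProjRep G H) (g h f : H) :
    coeff π (g + h) f = coeff π g f + coeff π h f :=
  funext fun x => by simp only [coeff, map_add, inner_add_left, Pi.add_apply]

theorem coeff_smul_left (π : ProjRep G H) (a : ℂ) (g f : H) :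
    coeff π (a • g) f = conj a • coeff π g f :=
  funext fun x => by simp only [coeff, map_smul, inner_smul_left, Pi.smul_apply, smul_eq_mul]

theorem stronglyMeasurable_coeff (π : ProjRep G H) (g f : H) :
    StronglyMeasurable (coeff π g f) :=
  (π.stronglyMeasurable g).inner stronglyMeasurable_const

end Basic

section Continuity

variable {G H : Type*} [Group G] [TopologicalSpace G] [IsTopologicalGroup G]
  [LocallyCompactSpace G] [MeasurableSpace G] [BorelSpace G]

/-- Steinhaus' theorem, applied to the preimage of a small ball which has positive measure. -/
theorem exists_nhds_one_dist_lt {E : Type*} [PseudoMetricSpace E] {φ : G → E}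
    (hφ : StronglyMeasurable φ) {ε : ℝ} (hε : 0 < ε) :
    ∃ U ∈ 𝓝 (1 : G), ∀ u ∈ U, ∃ x, dist (φ (x * u)) (φ x) < ε := by
  obtain ⟨c, hc, hφc⟩ := hφ.isSeparable_range
  obtain ⟨K, hK, hKc, hKcl⟩ := exists_mem_nhds_isCompact_isClosed (1 : G)
  let S : E → Set G := fun e => {a | dist (φ a⁻¹) e < ε / 2}
  have hS : ∀ e, MeasurableSet (S e) := fun e => measurableSet_lt
    ((hφ.comp_measurable measurable_inv).dist stronglyMeasurable_const).measurable
    measurable_const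
  obtain ⟨e, -, he⟩ : ∃ e ∈ c, Measure.haar (K ∩ S e) ≠ 0 := by
    by_contra! h
    refine (Measure.measure_pos_of_mem_nhds Measure.haar hK).ne' ?_
    refine measure_mono_null (fun a ha => ?_) ((measure_biUnion_null_iff hc).2 h)
    obtain ⟨e, he, hlt⟩ :=
      Metric.mem_closure_iff.1 (hφc (mem_range_self a⁻¹)) (ε / 2) (half_pos hε)
    exact mem_biUnion he ⟨ha, hlt⟩
  refine ⟨_, Measure.div_mem_nhds_one_of_haar_pos_ne_top Measure.haar (K ∩ S e)
    (hKcl.measurableSet.inter (hS e)) (pos_iff_ne_zero.2 he)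
    ((measure_mono inter_subset_left).trans_lt hKc.measure_lt_top).ne, ?_⟩
  rintro _ ⟨a, ⟨-, ha⟩, b, ⟨-, hb⟩, rfl⟩
  refine ⟨a⁻¹, ?_⟩
  simp only [div_eq_mul_inv, inv_mul_cancel_left]
  calc dist (φ b⁻¹) (φ a⁻¹) ≤ dist (φ b⁻¹) e + dist (φ a⁻¹) e := dist_triangle_right _ _ _
    _ < ε / 2 + ε / 2 := add_lt_add hb ha
    _ = ε := add_halves ε

variable [NormedAddCommGroup H] [InnerProductSpace ℂ H]

theorem ProjRep.exists_nhds_one_norm_sub_smul_lt (π : ProjRep G H) (g : H) {ε : ℝ} (hε : 0 < ε) :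
    ∃ U ∈ 𝓝 (1 : G), ∀ u ∈ U, ∃ θ : Circle, ‖π u g - θ • g‖ < ε := by
  obtain ⟨U, hU, h⟩ := exists_nhds_one_dist_lt (π.stronglyMeasurable g) hε
  refine ⟨U, hU, fun u hu => ?_⟩
  obtain ⟨x, hx⟩ := h u hu
  refine ⟨π.cocycle x u, ?_⟩
  rwa [← (π x).norm_map, map_sub, π.mul_apply, Circle.smul_def, map_smul, ← smul_sub, norm_smul,
    Circle.norm_coe, one_mul, ← dist_eq_norm]

theorem continuous_norm_coeff (π : ProjRep G H) (g f : H) :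
    Continuous fun x => ‖coeff π g f x‖ := by
  refine continuous_iff_continuousAt.2 fun x => Metric.tendsto_nhds.2 fun ε hε => ?_
  have hf : 0 < ‖f‖ + 1 := by positivity
  obtain ⟨U, hU, hUε⟩ := π.exists_nhds_one_norm_sub_smul_lt g (div_pos hε hf)
  rw [← map_mul_left_nhds_one x, eventually_map]
  filter_upwards [hU] with u hu
  obtain ⟨θ, hθ⟩ := hUε u hu
  have hθg : ‖coeff π g f x‖ = ‖coeff π (θ • g) f x‖ := by
    rw [Circle.smul_def, coeff_smul_left, Pi.smul_apply, norm_smul, RCLike.norm_conj,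
      Circle.norm_coe, one_mul]
  rw [Real.dist_eq, ← norm_coeff_apply_left, hθg]
  calc |‖coeff π (π u g) f x‖ - ‖coeff π (θ • g) f x‖|
      ≤ ‖coeff π (π u g) f x - coeff π (θ • g) f x‖ := abs_norm_sub_norm_le _ _
    _ ≤ ‖π u g - θ • g‖ * ‖f‖ := norm_coeff_sub_left_le π _ _ f x
    _ ≤ ‖π u g - θ • g‖ * (‖f‖ + 1) := by gcongr; exact le_add_of_nonneg_right zero_le_one
    _ < ε / (‖f‖ + 1) * (‖f‖ + 1) := by gcongr
    _ = ε := div_mul_cancel₀ _ hf.ne'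

end Continuity

section Schur

variable {G H : Type*} [Group G] [MeasurableSpace G] [NormedAddCommGroup H]
  [InnerProductSpace ℂ H] {π : ProjRep G H} {T : H →L[ℂ] H}

theorem IsIrreducible.eq_zero_or_injective (hπ : IsIrreducible π)
    (hT : ∀ x f, T (π x f) = π x (T f)) : T = 0 ∨ Function.Injective T := by
  have hker : ∀ x, ∀ f ∈ T.ker, π x f ∈ T.ker := fun x f hf => by
    have hf : T f = 0 := hf
    change T (π x f) = 0
    rw [hT, hf, map_zero]
  rcases hπ T.ker T.isClosed_ker hker with h | h
  · exact Or.inr (LinearMap.ker_eq_bot.1 h)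
  · exact Or.inl (ContinuousLinearMap.ext fun f => show f ∈ T.ker from h ▸ Submodule.mem_top)

variable [CompleteSpace H]

theorem IsIrreducible.nonneg_or_nonpos (hπ : IsIrreducible π) (hTs : IsSelfAdjoint T)
    (hT : ∀ x f, T (π x f) = π x (T f)) : 0 ≤ T ∨ T ≤ 0 := by
  have hpos : ∀ x f, T⁺ (π x f) = π x (T⁺ f) := fun x f => by
    have hcomm : Commute T ((π x).toContinuousLinearEquiv : H →L[ℂ] H) :=
      ContinuousLinearMap.ext (hT x)
    exact DFunLike.congr_fun (hcomm.cfcₙ_real (·⁺)).eq f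
  rcases hπ.eq_zero_or_injective hpos with h | h
  · exact Or.inr ((CFC.posPart_eq_zero_iff T).1 h)
  · refine Or.inl ((CFC.negPart_eq_zero_iff T).1 (ContinuousLinearMap.ext fun f => h ?_))
    rw [zero_apply, map_zero]
    exact DFunLike.congr_fun (CFC.posPart_mul_negPart T) f

/-- **Schur's lemma** for self-adjoint operators. -/
theorem IsIrreducible.exists_eq_algebraMap (hπ : IsIrreducible π) (hTs : IsSelfAdjoint T)
    (hT : ∀ x f, T (π x f) = π x (T f)) : ∃ c : ℝ, T = algebraMap ℝ (H →L[ℂ] H) c := by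
  rcases subsingleton_or_nontrivial H with _ | _
  · exact ⟨0, Subsingleton.elim _ _⟩
  have hcut : ∀ c : ℝ, (∀ a ∈ spectrum ℝ T, c ≤ a) ∨ ∀ a ∈ spectrum ℝ T, a ≤ c := fun c => by
    rw [← algebraMap_le_iff_le_spectrum, ← le_algebraMap_iff_spectrum_le, ← sub_nonneg,
      ← sub_nonpos (a := T)]
    exact hπ.nonneg_or_nonpos (hTs.sub (.algebraMap _ (.all c))) fun x f => by
      simp [hT, Algebra.algebraMap_eq_smul_one, ← Complex.coe_smul]
  obtain ⟨a, ha⟩ := ContinuousFunctionalCalculus.spectrum_nonempty (R := ℝ) T hTs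
  refine ⟨a, CFC.eq_algebraMap_of_spectrum_subset_singleton T a fun b hb => ?_⟩
  have hab := hcut ((a + b) / 2)
  exact mem_singleton_iff.2 <| le_antisymm
    (hab.elim (fun h => by linarith [h a ha]) fun h => by linarith [h b hb])
    (hab.elim (fun h => by linarith [h b hb]) fun h => by linarith [h a ha])

variable {E : Type*} [NormedAddCommGroup E] [InnerProductSpace ℂ E] [CompleteSpace E]
  {p : E →L[ℂ] H} {ρ : G → E ≃ₗᵢ[ℂ] E}

theorem adjoint_apply_of_intertwining (hρ : ∀ x ξ, p (ρ x ξ) = π x (p ξ)) (x : G) (f : H) :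
    p.adjoint (π x f) = ρ x (p.adjoint f) := by
  refine ext_inner_right ℂ fun η => ?_
  obtain ⟨η, rfl⟩ := (ρ x).surjective η
  simp only [ContinuousLinearMap.adjoint_inner_left, LinearIsometryEquiv.inner_map_map, hρ]

theorem IsIrreducible.exists_pos_adjoint_eq [Nontrivial E] (hπ : IsIrreducible π)
    (hp : Function.Injective p) (hρ : ∀ x ξ, p (ρ x ξ) = π x (p ξ)) :
    ∃ c : ℝ, 0 < c ∧ (∀ f, p (p.adjoint f) = (c : ℂ) • f) ∧ ∀ ξ, ‖p ξ‖ ^ 2 = c * ‖ξ‖ ^ 2 := by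
  obtain ⟨c, hc⟩ := hπ.exists_eq_algebraMap (T := p ∘L p.adjoint)
    (ContinuousLinearMap.isPositive_self_comp_adjoint p).isSelfAdjoint
    (fun x f => by simp [adjoint_apply_of_intertwining hρ, hρ])
  have hpadj : ∀ f, p (p.adjoint f) = (c : ℂ) • f := fun f => by
    simpa [Algebra.algebraMap_eq_smul_one] using DFunLike.congr_fun hc f
  have hadjp : ∀ ξ, p.adjoint (p ξ) = (c : ℂ) • ξ := fun ξ => hp (by rw [hpadj, map_smul])
  have hnorm : ∀ ξ, ‖p ξ‖ ^ 2 = c * ‖ξ‖ ^ 2 := fun ξ => by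
    have h : inner ℂ (p ξ) (p ξ) = (c : ℂ) * inner ℂ ξ ξ := by
      rw [← ContinuousLinearMap.adjoint_inner_right, hadjp, inner_smul_right]
    simp only [inner_self_eq_norm_sq_to_K, Complex.coe_algebraMap] at h
    exact_mod_cast h
  obtain ⟨ξ, hξ⟩ := exists_ne (0 : E)
  have hpξ : p ξ ≠ 0 := (map_ne_zero_iff p hp).2 hξ
  have hc0 : 0 < c * ‖ξ‖ ^ 2 := hnorm ξ ▸ by positivity
  exact ⟨c, pos_of_mul_pos_left hc0 (by positivity), hpadj, hnorm⟩

theorem IsIrreducible.surjective_and_norm_sq_eq [Nontrivial E] (hπ : IsIrreducible π)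
    (hp : Function.Injective p) (hρ : ∀ x ξ, p (ρ x ξ) = π x (p ξ)) :
    Function.Surjective p ∧ ∃ c : ℝ, ∀ ξ, ‖ξ‖ ^ 2 = c * ‖p ξ‖ ^ 2 := by
  obtain ⟨c, hc, hadj, hnorm⟩ := hπ.exists_pos_adjoint_eq hp hρ
  refine ⟨fun f => ⟨(c⁻¹ : ℂ) • p.adjoint f, ?_⟩, c⁻¹, fun ξ => ?_⟩
  · rw [map_smul, hadj, inv_smul_smul₀ (by exact_mod_cast hc.ne')]
  · rw [hnorm, inv_mul_cancel_left₀ hc.ne']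

end Schur

section InvInvariant

variable {G : Type*} [Group G] [TopologicalSpace G] [IsTopologicalGroup G] [LocallyCompactSpace G]
  [SecondCountableTopology G] [MeasurableSpace G] [BorelSpace G]

theorem isInvInvariant_of_isMulRightInvariant (μ : Measure G) [μ.IsHaarMeasure]
    [μ.IsMulRightInvariant] : μ.IsInvInvariant := by
  have : IsFiniteMeasureOnCompacts μ.inv :=
    ⟨fun K hK => by rw [Measure.inv_apply]; exact hK.inv.measure_lt_top⟩
  obtain ⟨c, hc⟩ : ∃ c : NNReal, μ.inv = c • μ := ⟨_, Measure.isMulLeftInvariant_eq_smul μ.inv μ⟩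
  obtain ⟨K, hK, hK1⟩ := exists_compact_mem_nhds (1 : G)
  -- a symmetric set of positive finite measure detects the factor `c`
  have hS : (K ∪ K⁻¹)⁻¹ = K ∪ K⁻¹ := by rw [union_inv, inv_inv, union_comm]
  have hpos : μ (K ∪ K⁻¹) ≠ 0 :=
    (Measure.measure_pos_of_mem_nhds μ (mem_of_superset hK1 subset_union_left)).ne'
  have hfin : μ (K ∪ K⁻¹) ≠ ∞ := (hK.union hK.inv).measure_ne_top
  have hc1 : (c : ℝ≥0∞) * μ (K ∪ K⁻¹) = μ (K ∪ K⁻¹) :=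
    calc c * μ (K ∪ K⁻¹) = μ.inv (K ∪ K⁻¹) := by rw [hc]; rfl
      _ = μ (K ∪ K⁻¹) := by rw [Measure.inv_apply, hS]
  rw [ENNReal.mul_eq_right hpos hfin, ENNReal.coe_eq_one] at hc1
  exact ⟨by rw [hc, hc1, one_smul]⟩

end InvInvariant

theorem norm_toLp_sq_eq_integral {α E : Type*} [MeasurableSpace α] {μ : Measure α}
    [NormedAddCommGroup E] {f : α → E} (hf : MemLp f 2 μ) :
    ‖hf.toLp f‖ ^ 2 = ∫ x, ‖f x‖ ^ 2 ∂μ := by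
  have h0 : 0 ≤ ∫ x, ‖f x‖ ^ 2 ∂μ := integral_nonneg fun x => by positivity
  rw [Lp.norm_toLp, hf.eLpNorm_eq_integral_rpow_norm two_ne_zero ENNReal.ofNat_ne_top]
  simp only [ENNReal.toReal_ofNat, Real.rpow_two, ← one_div, ← Real.sqrt_eq_rpow]
  rw [ENNReal.toReal_ofReal (Real.sqrt_nonneg _), Real.sq_sqrt h0]

section Graph

variable {G H : Type*} [Group G] [MeasurableSpace G] [NormedAddCommGroup H]
  [InnerProductSpace ℂ H] {μ : Measure G} {π : ProjRep G H} {g : H}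

/-- The graph of the unbounded operator `f ↦ V_g f` from `H` to `L²(G)`, whose domain consists of
the `f` with square-integrable coefficient. -/
noncomputable def coeffGraph (μ : Measure G) (π : ProjRep G H) (g : H) :
    Submodule ℂ (WithLp 2 (H × Lp ℂ 2 μ)) where
  carrier := {ξ | ξ.snd =ᵐ[μ] coeff π g ξ.fst}
  zero_mem' := by
    filter_upwards [Lp.coeFn_zero ℂ 2 μ] with x hx
    simp only [WithLp.zero_snd, WithLp.zero_fst, coeff, inner_zero_right]
    exact hx
  add_mem' {ξ η} hξ hη := by
    simp only [mem_ofPred_eq, WithLp.add_fst, WithLp.add_snd, coeff_add] at hξ hη ⊢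
    exact (Lp.coeFn_add ξ.snd η.snd).trans (hξ.add hη)
  smul_mem' a ξ hξ := by
    simp only [mem_ofPred_eq, WithLp.smul_fst, WithLp.smul_snd, coeff_smul] at hξ ⊢
    exact (Lp.coeFn_smul a ξ.snd).trans (hξ.const_smul a)

theorem mem_coeffGraph {ξ : WithLp 2 (H × Lp ℂ 2 μ)} :
    ξ ∈ coeffGraph μ π g ↔ ξ.snd =ᵐ[μ] coeff π g ξ.fst := Iff.rfl

theorem isClosed_coeffGraph (μ : Measure G) (π : ProjRep G H) (g : H) :
    IsClosed (coeffGraph μ π g : Set (WithLp 2 (H × Lp ℂ 2 μ))) := by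
  refine IsSeqClosed.isClosed fun u ξ hu hlim => ?_
  have hfst : Tendsto (fun n => (u n).fst) atTop (𝓝 ξ.fst) :=
    ((WithLp.prod_continuous_ofLp 2 H (Lp ℂ 2 μ)).fst.tendsto ξ).comp hlim
  have hsnd : Tendsto (fun n => (u n).snd) atTop (𝓝 ξ.snd) :=
    ((WithLp.prod_continuous_ofLp 2 H (Lp ℂ 2 μ)).snd.tendsto ξ).comp hlim
  obtain ⟨φ, hφ, hae⟩ := (tendstoInMeasure_of_tendsto_Lp hsnd).exists_seq_tendsto_ae
  have hall : ∀ᵐ x ∂μ, ∀ n, (u n).snd x = coeff π g (u n).fst x := ae_all_iff.2 fun n => hu n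
  refine mem_coeffGraph.2 ?_
  filter_upwards [hae, hall] with x hx hn
  simp only [hn] at hx
  exact tendsto_nhds_unique hx (tendsto_const_nhds.inner (hfst.comp hφ.tendsto_atTop))

instance [CompleteSpace H] : CompleteSpace (coeffGraph μ π g) :=
  (isClosed_coeffGraph μ π g).completeSpace_coe

namespace coeffGraph

/-- The projection of the graph of `f ↦ V_g f` to its domain. -/
noncomputable def fst : coeffGraph μ π g →L[ℂ] H :=
  WithLp.fstL 2 ℂ H (Lp ℂ 2 μ) ∘L (coeffGraph μ π g).subtypeL

/-- The point of the graph over a vector of the domain. -/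
noncomputable def mk (f : H) (hf : MemLp (coeff π g f) 2 μ) : coeffGraph μ π g :=
  ⟨WithLp.toLp 2 (f, hf.toLp _), hf.coeFn_toLp⟩

theorem fst_mk (f : H) (hf : MemLp (coeff π g f) 2 μ) : fst (mk f hf) = f := rfl

theorem memLp_fst (ξ : coeffGraph μ π g) : MemLp (coeff π g (fst ξ)) 2 μ :=
  (memLp_congr_ae (mem_coeffGraph.1 ξ.2)).1 (Lp.memLp ξ.1.snd)

theorem snd_eq_toLp (ξ : coeffGraph μ π g) : ξ.1.snd = (memLp_fst ξ).toLp _ :=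
  Lp.ext ((mem_coeffGraph.1 ξ.2).trans (memLp_fst ξ).coeFn_toLp.symm)

theorem fst_injective : Function.Injective (fst : coeffGraph μ π g → H) := fun ξ η h => by
  have hsnd : ξ.1.snd = η.1.snd := by simp only [snd_eq_toLp, h]
  exact Subtype.ext (WithLp.ofLp_injective 2 (Prod.ext h hsnd))

theorem norm_sq_eq (ξ : coeffGraph μ π g) :
    ‖ξ‖ ^ 2 = ‖fst ξ‖ ^ 2 + ∫ x, ‖coeff π g (fst ξ) x‖ ^ 2 ∂μ := by
  rw [Submodule.coe_norm, WithLp.prod_norm_sq_eq_of_L2, snd_eq_toLp, norm_toLp_sq_eq_integral]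
  rfl

end coeffGraph

variable [MeasurableMul₂ G] [μ.IsMulLeftInvariant]

theorem memLp_coeff_apply {f : H} (hf : MemLp (coeff π g f) 2 μ) (y : G) :
    MemLp (coeff π g (π y f)) 2 μ :=
  (hf.comp_measurePreserving (measurePreserving_mul_left μ y⁻¹)).congr_norm
    (stronglyMeasurable_coeff π g _).aestronglyMeasurable
    (ae_of_all _ fun x => (norm_coeff_apply π g f y x).symm)

theorem memLp_coeff_symm_apply {f : H} (hf : MemLp (coeff π g f) 2 μ) (y : G) :
    MemLp (coeff π g ((π y).symm f)) 2 μ := by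
  refine (hf.comp_measurePreserving (measurePreserving_mul_left μ y)).congr_norm
    (stronglyMeasurable_coeff π g _).aestronglyMeasurable (ae_of_all _ fun x => ?_)
  have h := norm_coeff_apply π g ((π y).symm f) y (y * x)
  rwa [LinearIsometryEquiv.apply_symm_apply, inv_mul_cancel_left] at h

theorem integral_norm_coeff_apply_sq (π : ProjRep G H) (g f : H) (y : G) :
    ∫ x, ‖coeff π g (π y f) x‖ ^ 2 ∂μ = ∫ x, ‖coeff π g f x‖ ^ 2 ∂μ := by
  simp only [norm_coeff_apply]
  exact integral_mul_left_eq_self (fun x => ‖coeff π g f x‖ ^ 2) y⁻¹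

/-- The action of `π x` on the graph of `f ↦ V_g f`, which is isometric for the graph norm. -/
noncomputable def coeffGraph.rep (x : G) : coeffGraph μ π g ≃ₗᵢ[ℂ] coeffGraph μ π g where
  toFun ξ := mk (π x (fst ξ)) (memLp_coeff_apply (memLp_fst ξ) x)
  invFun ξ := mk ((π x).symm (fst ξ)) (memLp_coeff_symm_apply (memLp_fst ξ) x)
  map_add' ξ η := fst_injective (by simp only [fst_mk, map_add])
  map_smul' a ξ := fst_injective (by simp only [fst_mk, map_smul, RingHom.id_apply])
  left_inv ξ := fst_injective (by simp only [fst_mk, LinearIsometryEquiv.symm_apply_apply])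
  right_inv ξ := fst_injective (by simp only [fst_mk, LinearIsometryEquiv.apply_symm_apply])
  norm_map' ξ := (sq_eq_sq₀ (norm_nonneg _) (norm_nonneg _)).1 <| by
    change ‖mk (π x (fst ξ)) (memLp_coeff_apply (memLp_fst ξ) x)‖ ^ 2 = ‖ξ‖ ^ 2
    rw [norm_sq_eq, norm_sq_eq, fst_mk, LinearIsometryEquiv.norm_map,
      integral_norm_coeff_apply_sq]

theorem IsIrreducible.exists_integral_norm_coeff_sq_eq [CompleteSpace H] (hπ : IsIrreducible π)
    {f₀ : H} (hf₀ : f₀ ≠ 0) (h₀ : MemLp (coeff π g f₀) 2 μ) :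
    ∃ c : ℝ, ∀ f, MemLp (coeff π g f) 2 μ ∧ ∫ x, ‖coeff π g f x‖ ^ 2 ∂μ = c * ‖f‖ ^ 2 := by
  have : Nontrivial (coeffGraph μ π g) :=
    ⟨coeffGraph.mk f₀ h₀, 0, fun h => hf₀ (by rw [← coeffGraph.fst_mk f₀ h₀, h, map_zero])⟩
  obtain ⟨hsurj, c, hc⟩ := hπ.surjective_and_norm_sq_eq (p := coeffGraph.fst (μ := μ) (g := g))
    (ρ := coeffGraph.rep) coeffGraph.fst_injective fun x ξ => rfl
  refine ⟨c - 1, fun f => ?_⟩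
  obtain ⟨ξ, rfl⟩ := hsurj f
  refine ⟨coeffGraph.memLp_fst ξ, ?_⟩
  linarith [coeffGraph.norm_sq_eq ξ, hc ξ]

end Graph

section Polarization

variable {E E' F : Type*} [NormedAddCommGroup E] [InnerProductSpace ℂ E] [NormedAddCommGroup E']
  [InnerProductSpace ℂ E'] [NormedAddCommGroup F] [InnerProductSpace ℂ F]

theorem eq_zero_of_isAlt {V M : Type*} [AddCommGroup V] [Module ℂ V] [AddCommGroup M] [Module ℂ M]
    {B : V →ₗ⋆[ℂ] V →ₗ[ℂ] M} (hB : B.IsAlt) : B = 0 := by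
  refine LinearMap.ext₂ fun x y => ?_
  have h : -(Complex.I • B x y) = Complex.I • B x y :=
    calc -(Complex.I • B x y) = -B x (Complex.I • y) := by rw [map_smul]
      _ = B (Complex.I • y) x := hB.neg x (Complex.I • y)
      _ = -(Complex.I • B y x) := by rw [map_smulₛₗ, Complex.conj_I, LinearMap.smul_apply, neg_smul]
      _ = Complex.I • B x y := by rw [← hB.neg x y, smul_neg, neg_neg]
  have h2 : (2 * Complex.I) • B x y = 0 := by
    rw [mul_smul, two_smul, ← neg_eq_iff_add_eq_zero, h]
  exact (smul_eq_zero_iff_right (mul_ne_zero two_ne_zero Complex.I_ne_zero)).1 h2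

theorem sesqForm_ext_of_diag {V M : Type*} [AddCommGroup V] [Module ℂ V] [AddCommGroup M]
    [Module ℂ M] {B B' : V →ₗ⋆[ℂ] V →ₗ[ℂ] M} (h : ∀ x, B x x = B' x x) : B = B' :=
  sub_eq_zero.1 (eq_zero_of_isAlt fun x => by simp [h])

theorem inner_apply_apply_of_norm_sq_eq {T : E →ₗ⋆[ℂ] E' →ₗ[ℂ] F} {c : ℝ}
    (hT : ∀ g f, ‖T g f‖ ^ 2 = c * ‖f‖ ^ 2 * ‖g‖ ^ 2) (g₁ g₂ : E) (f₁ f₂ : E') :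
    inner ℂ (T g₂ f₂) (T g₁ f₁) = c * inner ℂ f₂ f₁ * inner ℂ g₁ g₂ := by
  have hf : ∀ g, ((innerₛₗ ℂ).comp (T g)).compl₂ (T g) = (c * (‖g‖ : ℂ) ^ 2) • innerₛₗ ℂ :=
    fun g => sesqForm_ext_of_diag fun f => by
      simp only [LinearMap.compl₂_apply, LinearMap.coe_comp, Function.comp_apply,
        innerₛₗ_apply_apply, inner_self_eq_norm_sq_to_K, Complex.coe_algebraMap,
        ← Complex.ofReal_pow, hT, Complex.ofReal_mul, LinearMap.smul_apply, smul_eq_mul]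
      ring
  have hg : (((innerₛₗ ℂ).comp (T.flip f₂)).compl₂ (T.flip f₁)).flip =
      (c * inner ℂ f₂ f₁ : ℂ) • innerₛₗ ℂ := sesqForm_ext_of_diag fun g => by
    have h : inner ℂ (T g f₂) (T g f₁) = c * (‖g‖ : ℂ) ^ 2 * inner ℂ f₂ f₁ :=
      LinearMap.congr_fun₂ (hf g) f₂ f₁
    simp only [LinearMap.compl₂_apply, LinearMap.coe_comp, Function.comp_apply,
      innerₛₗ_apply_apply, LinearMap.smul_apply, smul_eq_mul, LinearMap.flip_apply,
      inner_self_eq_norm_sq_to_K, Complex.coe_algebraMap, h]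
    ring
  exact LinearMap.congr_fun₂ hg g₁ g₂

end Polarization

section Orthogonality

variable {G H : Type*} [Group G] [MeasurableSpace G] [NormedAddCommGroup H]
  [InnerProductSpace ℂ H] {μ : Measure G} {π : ProjRep G H}

/-- The coefficient transform `(g, f) ↦ V_g f` as a sesquilinear map into `L²(G)`, for a
representation all of whose coefficients are square-integrable. -/
noncomputable def coeffLp (h : ∀ g f, MemLp (coeff π g f) 2 μ) : H →ₗ⋆[ℂ] H →ₗ[ℂ] Lp ℂ 2 μ :=
  LinearMap.mk₂'ₛₗ (starRingEnd ℂ) (RingHom.id ℂ) (fun g f => (h g f).toLp (coeff π g f))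
    (fun g g' f => by simp only [coeff_add_left, MemLp.toLp_add (h g f) (h g' f)])
    (fun a g f => by simp only [coeff_smul_left, MemLp.toLp_const_smul _ (h g f)])
    (fun g f f' => by simp only [coeff_add, MemLp.toLp_add (h g f) (h g f')])
    (fun a g f => by simp only [coeff_smul, MemLp.toLp_const_smul _ (h g f), RingHom.id_apply])

theorem norm_coeffLp_sq (h : ∀ g f, MemLp (coeff π g f) 2 μ) (g f : H) :
    ‖coeffLp h g f‖ ^ 2 = ∫ x, ‖coeff π g f x‖ ^ 2 ∂μ :=
  norm_toLp_sq_eq_integral (h g f)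

theorem inner_coeffLp (h : ∀ g f, MemLp (coeff π g f) 2 μ) (g₁ g₂ f₁ f₂ : H) :
    inner ℂ (coeffLp h g₂ f₂) (coeffLp h g₁ f₁) =
      ∫ x, coeff π g₁ f₁ x * conj (coeff π g₂ f₂ x) ∂μ := by
  rw [L2.inner_def]
  refine integral_congr_ae ?_
  filter_upwards [(h g₁ f₁).coeFn_toLp, (h g₂ f₂).coeFn_toLp] with x h₁ h₂
  rw [← h₁, ← h₂]
  exact RCLike.inner_apply _ _

theorem isFormalDegree_of_integral_norm_coeff_sq_eq {d : ℝ} (hd : 0 < d)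
    (hL : ∀ g f, MemLp (coeff π g f) 2 μ)
    (h : ∀ g f, ∫ x, ‖coeff π g f x‖ ^ 2 ∂μ = d⁻¹ * ‖f‖ ^ 2 * ‖g‖ ^ 2) :
    IsFormalDegree μ π d := by
  refine ⟨hd, fun f₁ f₂ g₁ g₂ => ⟨(hL g₁ f₁).integrable_mul (hL g₂ f₂).star, ?_⟩⟩
  rw [← inner_coeffLp hL, inner_conj_symm, ← Complex.ofReal_inv]
  exact inner_apply_apply_of_norm_sq_eq (fun g f => by rw [norm_coeffLp_sq, h]) g₁ g₂ f₁ f₂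

theorem memLp_coeff_iff_lintegral_lt_top (π : ProjRep G H) (g f : H) :
    MemLp (coeff π g f) 2 μ ↔ ∫⁻ x, ‖coeff π g f x‖ₑ ^ 2 ∂μ < ∞ := by
  rw [MemLp, and_iff_right (stronglyMeasurable_coeff π g f).aestronglyMeasurable,
    eLpNorm_lt_top_iff_lintegral_rpow_enorm_lt_top two_ne_zero ENNReal.ofNat_ne_top]
  simp only [ENNReal.toReal_ofNat, ENNReal.rpow_two]

theorem IsFormalDegree.memLp_coeff {d : ℝ} (hd : IsFormalDegree μ π d) (g f : H) :
    MemLp (coeff π g f) 2 μ := by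
  rw [memLp_two_iff_integrable_sq_norm (stronglyMeasurable_coeff π g f).aestronglyMeasurable]
  refine (hd.2 f f g g).1.norm.congr (ae_of_all _ fun x => ?_)
  simp only [norm_mul, RCLike.norm_conj, sq]

theorem IsFormalDegree.integral_norm_coeff_sq {d : ℝ} (hd : IsFormalDegree μ π d) (g f : H) :
    d * ∫ x, ‖coeff π g f x‖ ^ 2 ∂μ = ‖f‖ ^ 2 * ‖g‖ ^ 2 := by
  have h : ((∫ x, ‖coeff π g f x‖ ^ 2 ∂μ : ℝ) : ℂ) = d⁻¹ * ‖f‖ ^ 2 * ‖g‖ ^ 2 := by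
    rw [← integral_complex_ofReal]
    simpa [Complex.mul_conj, Complex.normSq_eq_norm_sq, inner_self_eq_norm_sq_to_K]
      using (hd.2 f f g g).2
  rw [show ∫ x, ‖coeff π g f x‖ ^ 2 ∂μ = d⁻¹ * ‖f‖ ^ 2 * ‖g‖ ^ 2 by exact_mod_cast h, mul_assoc,
    mul_inv_cancel_left₀ hd.1.ne']

theorem IsFormalDegree.lintegral_enorm_coeff_sq {d : ℝ} (hd : IsFormalDegree μ π d) (g f : H) :
    ENNReal.ofReal d * ∫⁻ x, ‖coeff π g f x‖ₑ ^ 2 ∂μ = ‖f‖ₑ ^ 2 * ‖g‖ₑ ^ 2 := by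
  have hint : Integrable (fun x => ‖coeff π g f x‖ ^ 2) μ :=
    (memLp_two_iff_integrable_sq_norm (hd.memLp_coeff g f).1).1 (hd.memLp_coeff g f)
  have h : ∫⁻ x, ‖coeff π g f x‖ₑ ^ 2 ∂μ = ENNReal.ofReal (∫ x, ‖coeff π g f x‖ ^ 2 ∂μ) := by
    rw [ofReal_integral_eq_lintegral_ofReal hint (ae_of_all _ fun x => by positivity)]
    simp only [ENNReal.ofReal_pow (norm_nonneg _), ofReal_norm]
  rw [h, ← ENNReal.ofReal_mul hd.1.le, hd.integral_norm_coeff_sq,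
    ENNReal.ofReal_mul (by positivity), ENNReal.ofReal_pow (norm_nonneg _),
    ENNReal.ofReal_pow (norm_nonneg _), ofReal_norm, ofReal_norm]

section InvInvariant

variable [MeasurableInv G] [μ.IsInvInvariant]

theorem memLp_coeff_swap {g f : H} (h : MemLp (coeff π f g) 2 μ) : MemLp (coeff π g f) 2 μ :=
  (h.comp_measurePreserving (Measure.measurePreserving_inv μ)).congr_norm
    (stronglyMeasurable_coeff π g f).aestronglyMeasurable
    (ae_of_all _ fun x => (norm_coeff_inv π g f x).symm)

theorem integral_norm_coeff_sq_swap (g f : H) :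
    ∫ x, ‖coeff π g f x‖ ^ 2 ∂μ = ∫ x, ‖coeff π f g x‖ ^ 2 ∂μ := by
  rw [← integral_inv_eq_self (fun x => ‖coeff π f g x‖ ^ 2)]
  simp only [← norm_coeff_inv]

end InvInvariant

variable [TopologicalSpace G] [IsTopologicalGroup G] [LocallyCompactSpace G]
  [BorelSpace G] [μ.IsHaarMeasure]

theorem integral_norm_coeff_self_sq_pos {g : H} (hg : g ≠ 0) (h : MemLp (coeff π g g) 2 μ) :
    0 < ∫ x, ‖coeff π g g x‖ ^ 2 ∂μ := by
  have hcont : Continuous fun x => ‖coeff π g g x‖ ^ 2 := (continuous_norm_coeff π g g).pow 2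
  refine (integral_pos_iff_support_of_nonneg (fun x => by positivity)
    ((memLp_two_iff_integrable_sq_norm h.1).1 h)).2 (hcont.isOpen_support.measure_pos μ ⟨1, ?_⟩)
  rw [Function.mem_support, norm_coeff_one]
  simpa using hg

variable [SecondCountableTopology G] [μ.IsMulRightInvariant] [CompleteSpace H]

theorem IsDiscreteSeries.exists_isFormalDegree (hπ : IsDiscreteSeries μ π) :
    ∃ d : ℝ, IsFormalDegree μ π d := by
  have := isInvInvariant_of_isMulRightInvariant μ
  obtain ⟨g₀, hg₀, hint⟩ := hπ.squareIntegrable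
  have hL : MemLp (coeff π g₀ g₀) 2 μ := (memLp_coeff_iff_lintegral_lt_top π g₀ g₀).2 hint
  obtain ⟨c, hc⟩ := hπ.irreducible.exists_integral_norm_coeff_sq_eq hg₀ hL
  have : 0 < ‖g₀‖ := norm_pos_iff.2 hg₀
  have hc0 : 0 < c := by
    have h := integral_norm_coeff_self_sq_pos hg₀ hL
    rw [(hc g₀).2] at h
    exact pos_of_mul_pos_left h (by positivity)
  have hcoeff : ∀ g f : H, MemLp (coeff π g f) 2 μ ∧
      ∫ x, ‖coeff π g f x‖ ^ 2 ∂μ = (‖g₀‖ ^ 2 / c)⁻¹ * ‖f‖ ^ 2 * ‖g‖ ^ 2 := fun g f => by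
    obtain ⟨c', hc'⟩ :=
      hπ.irreducible.exists_integral_norm_coeff_sq_eq hg₀ (memLp_coeff_swap (hc g).1)
    have hcc' : c' * ‖g₀‖ ^ 2 = c * ‖g‖ ^ 2 := by
      rw [← (hc' g₀).2, integral_norm_coeff_sq_swap, (hc g).2]
    refine ⟨(hc' f).1, ?_⟩
    rw [(hc' f).2, eq_div_of_mul_eq (by positivity) hcc']
    field_simp
  exact ⟨_, isFormalDegree_of_integral_norm_coeff_sq_eq (by positivity) (fun g f => (hcoeff g f).1)
    fun g f => (hcoeff g f).2⟩

theorem IsDiscreteSeries.isFormalDegree_formalDegree (hπ : IsDiscreteSeries μ π) :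
    IsFormalDegree μ π (formalDegree μ π) := by
  rw [formalDegree, dif_pos hπ.exists_isFormalDegree]
  exact hπ.exists_isFormalDegree.choose_spec

end Orthogonality

section LocalMax

variable {G : Type*} [Group G] {F : G → ℂ}

theorem enorm_le_localMax {Q : Set G} (F : G → ℂ) (x : G) {z : G} (hz : z ∈ Q) :
    ‖F (x * z)‖ₑ ≤ localMax Q F x :=
  le_iSup₂ (f := fun z _ => ‖F (x * z)‖ₑ) z hz

theorem localMax_sq_le_sum {Q U : Set G} {t : Finset G}
    (ht : Q ⊆ ⋃ q ∈ t, (q * ·) ⁻¹' U) (F : G → ℂ) (x : G) :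
    localMax Q F x ^ 2 ≤ ∑ q ∈ t, localMax U F (x * q⁻¹) ^ 2 := by
  rw [localMax, ENNReal.iSup₂_pow_of_ne_zero _ two_ne_zero]
  refine iSup₂_le fun z hz => ?_
  obtain ⟨q, hq, hqz⟩ := mem_iUnion₂.1 (ht hz)
  calc ‖F (x * z)‖ₑ ^ 2 = ‖F (x * q⁻¹ * (q * z))‖ₑ ^ 2 := by rw [mul_assoc, inv_mul_cancel_left]
    _ ≤ localMax U F (x * q⁻¹) ^ 2 := by gcongr; exact enorm_le_localMax F _ hqz
    _ ≤ ∑ q ∈ t, localMax U F (x * q⁻¹) ^ 2 :=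
      Finset.single_le_sum (f := fun q => localMax U F (x * q⁻¹) ^ 2) (fun _ _ => zero_le) hq

variable [TopologicalSpace G] [IsTopologicalGroup G] [MeasurableSpace G] [BorelSpace G]

theorem measurable_localMax (Q : Set G) (hF : Continuous fun x => ‖F x‖) :
    Measurable (localMax Q F) := by
  refine LowerSemicontinuous.measurable (lowerSemicontinuous_biSup fun z _ => ?_)
  have h : Continuous fun x => ENNReal.ofReal ‖F (x * z)‖ :=
    ENNReal.continuous_ofReal.comp (hF.comp (continuous_mul_const z))
  simp only [ofReal_norm] at h
  exact h.lowerSemicontinuous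

theorem lintegral_localMax_sq_lt_top {μ : Measure G} [μ.IsMulRightInvariant] {Q U : Set G}
    (hF : Continuous fun x => ‖F x‖) (hU : U ∈ 𝓝 (1 : G)) (hQ : IsCompact (closure Q))
    (h : ∫⁻ x, localMax U F x ^ 2 ∂μ < ∞) : ∫⁻ x, localMax Q F x ^ 2 ∂μ < ∞ := by
  obtain ⟨t, ht⟩ := compact_covered_by_mul_left_translates hQ ⟨1, mem_interior_iff_mem_nhds.2 hU⟩
  have hm : ∀ q : G, Measurable fun x => localMax U F (x * q⁻¹) ^ 2 := fun q =>
    ((measurable_localMax U hF).pow_const 2).comp (measurable_mul_const q⁻¹)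
  calc ∫⁻ x, localMax Q F x ^ 2 ∂μ ≤ ∫⁻ x, ∑ q ∈ t, localMax U F (x * q⁻¹) ^ 2 ∂μ :=
        lintegral_mono (localMax_sq_le_sum (subset_closure.trans ht) F)
    _ = ∑ q ∈ t, ∫⁻ x, localMax U F x ^ 2 ∂μ := by
        rw [lintegral_finsetSum t fun q _ => hm q]
        exact Finset.sum_congr rfl fun q _ =>
          lintegral_mul_right_eq_self (fun x => localMax U F x ^ 2) q⁻¹
    _ < ∞ := ENNReal.sum_lt_top.2 fun q _ => h

end LocalMax

section Overlap

variable {G : Type*} [Group G] [MeasurableSpace G] {μ : Measure G}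

/-- The measure of the set of points outside `K` which right translation by `w` moves into `K * L`;
it is the kernel of the double integral defining `rieszError`. -/
noncomputable def overlap (μ : Measure G) (K L : Set G) (w : G) : ℝ≥0∞ :=
  μ (Kᶜ ∩ (· * w) ⁻¹' (K * L))

theorem measure_mul_le_add_measure_boundary {K L : Set G} (hL : (1 : G) ∈ L) :
    μ (K * L) ≤ μ K + μ ((K * L) ∩ (Kᶜ * L)) := by
  refine (measure_mono fun x hx => ?_).trans (measure_union_le _ _)
  exact (em (x ∈ K)).imp_right fun hxK => ⟨hx, x, hxK, 1, hL, mul_one x⟩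

theorem overlap_le_measure_mul [MeasurableMul G] [μ.IsMulRightInvariant] (K L : Set G) (w : G) :
    overlap μ K L w ≤ μ (K * L) :=
  (measure_mono inter_subset_right).trans_eq (measure_preimage_mul_right μ w _)

theorem overlap_le_measure_boundary [MeasurableMul G] [μ.IsMulRightInvariant] (K L : Set G)
    (w : G) : overlap μ K L w ≤ μ ((K * insert w L) ∩ (Kᶜ * insert w L)) := by
  rw [← measure_preimage_mul_right μ w]
  exact measure_mono fun y hy =>
    ⟨mul_subset_mul_left (subset_insert _ _) hy.2, mul_mem_mul hy.1 (mem_insert _ _)⟩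

variable [MeasurableMul₂ G] [SFinite μ]

theorem measurable_overlap {K L : Set G} (hK : MeasurableSet K) (hKL : MeasurableSet (K * L)) :
    Measurable (overlap μ K L) := by
  have hs : MeasurableSet {p : G × G | p.2 ∈ Kᶜ ∧ p.2 * p.1 ∈ K * L} :=
    (measurable_snd hK.compl).inter ((measurable_snd.mul measurable_fst) hKL)
  exact measurable_measure_prodMk_left hs

theorem lintegral_lintegral_inv_mul_eq [μ.IsMulLeftInvariant] {Φ : G → ℝ≥0∞} (hΦ : Measurable Φ)
    (S : Set G) {T : Set G} (hT : MeasurableSet T) :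
    ∫⁻ y in S, ∫⁻ z in T, Φ (y⁻¹ * z) ∂μ ∂μ = ∫⁻ w, Φ w * μ (S ∩ (· * w) ⁻¹' T) ∂μ := by
  have hm : Measurable fun p : G × G => Φ p.2 * T.indicator 1 (p.1 * p.2) :=
    (hΦ.comp measurable_snd).mul
      ((measurable_one.indicator hT).comp (measurable_fst.mul measurable_snd))
  calc ∫⁻ y in S, ∫⁻ z in T, Φ (y⁻¹ * z) ∂μ ∂μ
      = ∫⁻ y in S, ∫⁻ w, Φ w * T.indicator 1 (y * w) ∂μ ∂μ := by
        refine lintegral_congr fun y => ?_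
        rw [← lintegral_indicator hT, ← lintegral_mul_left_eq_self _ y]
        refine lintegral_congr fun w => ?_
        by_cases h : y * w ∈ T <;> simp [h]
    _ = ∫⁻ w, ∫⁻ y in S, Φ w * T.indicator 1 (y * w) ∂μ ∂μ :=
        lintegral_lintegral_swap hm.aemeasurable
    _ = ∫⁻ w, Φ w * μ (S ∩ (· * w) ⁻¹' T) ∂μ := by
        refine lintegral_congr fun w => ?_
        have hTw : MeasurableSet ((· * w) ⁻¹' T) := measurable_mul_const w hT
        have hind : (fun y => T.indicator (1 : G → ℝ≥0∞) (y * w)) =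
            ((· * w) ⁻¹' T).indicator 1 := rfl
        rw [lintegral_const_mul _ (hind ▸ measurable_one.indicator hTw), hind,
          lintegral_indicator_one hTw, Measure.restrict_apply hTw, inter_comm]

end Overlap

section Folner

variable {G : Type*} [Group G] [TopologicalSpace G] [MeasurableSpace G] [MeasurableMul G]
  {μ : Measure G} [μ.IsMulRightInvariant] {K : ℕ → Set G} {L : Set G}

theorem IsStrongFolner.tendsto_overlap_div (hK : IsStrongFolner μ K)
    (hL : IsCompact L) (w : G) :
    Tendsto (fun n => overlap μ (K n) L w / μ (K n)) atTop (𝓝 0) :=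
  tendsto_of_tendsto_of_tendsto_of_le_of_le tendsto_const_nhds
    (hK.tendsto (insert w L) (hL.insert w)) (fun _ => zero_le) fun _ =>
      ENNReal.div_le_div_right (overlap_le_measure_boundary _ _ w) _

variable [IsFiniteMeasureOnCompacts μ]

theorem IsStrongFolner.eventually_overlap_div_le (hK : IsStrongFolner μ K)
    (hL : IsCompact L) (hL1 : (1 : G) ∈ L) :
    ∀ᶠ n in atTop, ∀ w, overlap μ (K n) L w / μ (K n) ≤ 2 := by
  filter_upwards [(hK.tendsto L hL).eventually_le_const (zero_lt_one' ℝ≥0∞)] with n hn w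
  calc overlap μ (K n) L w / μ (K n)
      ≤ (μ (K n) + μ ((K n * L) ∩ ((K n)ᶜ * L))) / μ (K n) := by
        gcongr
        exact (overlap_le_measure_mul _ _ w).trans (measure_mul_le_add_measure_boundary hL1)
    _ ≤ 1 + 1 := by
        rw [ENNReal.add_div, ENNReal.div_self (hK.nonnull n) (hK.isCompact n).measure_ne_top]
        gcongr
    _ = 2 := one_add_one_eq_two

end Folner

section Kernel

variable {G : Type*} [Group G] [TopologicalSpace G] [IsTopologicalGroup G]
  [SecondCountableTopology G] [T2Space G] [MeasurableSpace G] [BorelSpace G] {μ : Measure G}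
  [IsFiniteMeasureOnCompacts μ] [SFinite μ] [μ.IsMulLeftInvariant] [μ.IsMulRightInvariant]
  {L : Set G} {Φ : G → ℝ≥0∞}

theorem IsStrongFolner.tendsto_lintegral_div {K : ℕ → Set G} (hK : IsStrongFolner μ K)
    (hΦ : Measurable Φ) (hΦi : ∫⁻ w, Φ w ∂μ < ∞) (hL : IsCompact L) (hL1 : (1 : G) ∈ L) :
    Tendsto (fun n => (∫⁻ y in (K n)ᶜ, ∫⁻ z in K n * L, Φ (y⁻¹ * z) ∂μ ∂μ) / μ (K n))
      atTop (𝓝 0) := by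
  have hKL : ∀ n, MeasurableSet (K n * L) := fun n => ((hK.isCompact n).mul hL).measurableSet
  have heq : ∀ n, (∫⁻ y in (K n)ᶜ, ∫⁻ z in K n * L, Φ (y⁻¹ * z) ∂μ ∂μ) / μ (K n) =
      ∫⁻ w, Φ w * (overlap μ (K n) L w / μ (K n)) ∂μ := fun n => by
    simp only [lintegral_lintegral_inv_mul_eq hΦ _ (hKL n), div_eq_mul_inv, ← mul_assoc]
    exact (lintegral_mul_const' _ _ (ENNReal.inv_ne_top.2 (hK.nonnull n))).symm
  have hmeas : ∀ n, Measurable fun w => Φ w * (overlap μ (K n) L w / μ (K n)) := fun n =>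
    hΦ.mul ((measurable_overlap (hK.isCompact n).measurableSet (hKL n)).div_const _)
  have hdom : ∫⁻ w, Φ w * 2 ∂μ ≠ ∞ := by
    rw [lintegral_mul_const _ hΦ]
    exact ENNReal.mul_ne_top hΦi.ne ENNReal.ofNat_ne_top
  have hlim : ∀ᵐ w ∂μ, Tendsto (fun n => Φ w * (overlap μ (K n) L w / μ (K n))) atTop (𝓝 0) := by
    filter_upwards [ae_lt_top hΦ hΦi.ne] with w hw
    simpa only [mul_zero] using
      ENNReal.Tendsto.const_mul (hK.tendsto_overlap_div hL w) (Or.inr hw.ne)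
  simp only [heq]
  simpa only [lintegral_zero] using tendsto_lintegral_filter_of_dominated_convergence
    (fun w => Φ w * 2) (Eventually.of_forall hmeas)
    ((hK.eventually_overlap_div_le hL hL1).mono fun _ hn => ae_of_all _ fun w =>
      mul_le_mul_right (hn w) _) hdom hlim

theorem lintegral_compl_mul_lt_top {K : Set G} (hK : IsCompact K) (hL : IsCompact L)
    (hΦ : Measurable Φ) (hΦi : ∫⁻ w, Φ w ∂μ < ∞) :
    ∫⁻ y in Kᶜ, ∫⁻ z in K * L, Φ (y⁻¹ * z) ∂μ ∂μ < ∞ :=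
  calc ∫⁻ y in Kᶜ, ∫⁻ z in K * L, Φ (y⁻¹ * z) ∂μ ∂μ
      = ∫⁻ w, Φ w * overlap μ K L w ∂μ :=
        lintegral_lintegral_inv_mul_eq hΦ _ (hK.mul hL).measurableSet
    _ ≤ ∫⁻ w, Φ w * μ (K * L) ∂μ :=
        lintegral_mono fun w => mul_le_mul_right (overlap_le_measure_mul K L w) _
    _ = (∫⁻ w, Φ w ∂μ) * μ (K * L) := lintegral_mul_const _ hΦ
    _ < ∞ := ENNReal.mul_lt_top hΦi (hK.mul hL).measure_lt_top

end Kernel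

section RieszError

theorem rieszError_le {G H : Type*} [Group G] [TopologicalSpace G] [MeasurableSpace G]
    [NormedAddCommGroup H] [InnerProductSpace ℂ H] (μ : Measure G) (π : ProjRep G H)
    (g : H) (Q K : Set G) :
    rieszError μ π g Q K ≤ ∫⁻ y in Kᶜ, ∫⁻ z in K * closure Q,
      localMax Q (coeff π g g) (y⁻¹ * z) ^ 2 ∂μ ∂μ :=
  lintegral_mono fun _ => lintegral_mono_set (mul_subset_mul_left subset_closure)

variable {G H : Type*} [Group G] [TopologicalSpace G] [IsTopologicalGroup G]
  [LocallyCompactSpace G] [MeasurableSpace G] [BorelSpace G] {μ : Measure G}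
  [μ.IsMulRightInvariant] [NormedAddCommGroup H] [InnerProductSpace ℂ H] {π : ProjRep G H}
  {Q : Set G} {g : H}

theorem measurable_localMax_coeff_sq (Q : Set G) (π : ProjRep G H) (g : H) :
    Measurable fun x => localMax Q (coeff π g g) x ^ 2 :=
  (measurable_localMax Q (continuous_norm_coeff π g g)).pow_const 2

theorem lintegral_localMax_coeff_sq_lt_top (hQ : IsSymmUnitNhd Q) (hg : g ∈ localized μ π) :
    ∫⁻ x, localMax Q (coeff π g g) x ^ 2 ∂μ < ∞ := by
  obtain ⟨U, hU, h⟩ := hg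
  exact lintegral_localMax_sq_lt_top (continuous_norm_coeff π g g) hU.mem_nhds hQ.relCompact h

variable [μ.IsHaarMeasure] [SecondCountableTopology G] [T2Space G]

theorem rieszError_lt_top (hQ : IsSymmUnitNhd Q) (hg : g ∈ localized μ π) {K : Set G}
    (hK : IsCompact K) : rieszError μ π g Q K < ∞ :=
  (rieszError_le μ π g Q K).trans_lt <| lintegral_compl_mul_lt_top hK hQ.relCompact
    (measurable_localMax_coeff_sq Q π g) (lintegral_localMax_coeff_sq_lt_top hQ hg)

theorem IsStrongFolner.rieszError_isLittleO {K : ℕ → Set G} (hK : IsStrongFolner μ K)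
    (hQ : IsSymmUnitNhd Q) (hg : g ∈ localized μ π) :
    (fun n => (rieszError μ π g Q (K n)).toReal) =o[atTop] (fun n => (μ (K n)).toReal) := by
  have hlim : Tendsto (fun n => rieszError μ π g Q (K n) / μ (K n)) atTop (𝓝 0) :=
    tendsto_of_tendsto_of_tendsto_of_le_of_le tendsto_const_nhds
      (hK.tendsto_lintegral_div (measurable_localMax_coeff_sq Q π g)
        (lintegral_localMax_coeff_sq_lt_top hQ hg) hQ.relCompact
        (subset_closure (mem_of_mem_nhds hQ.mem_nhds)))
      (fun _ => zero_le) fun n => ENNReal.div_le_div_right (rieszError_le μ π g Q (K n)) _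
  have hne : ∀ n, (μ (K n)).toReal ≠ 0 := fun n =>
    ENNReal.toReal_ne_zero.2 ⟨hK.nonnull n, (hK.isCompact n).measure_ne_top⟩
  refine (Asymptotics.isLittleO_iff_tendsto fun n hn => absurd hn (hne n)).2 ?_
  simpa only [Function.comp_def, ENNReal.toReal_div, ENNReal.toReal_zero] using
    (ENNReal.tendsto_toReal ENNReal.zero_ne_top).comp hlim

end RieszError

section RieszFischer

variable {𝕜 ι E : Type*} [RCLike 𝕜] [NormedAddCommGroup E]

/-- The subfamily of `v` indexed by `s` is a Riesz–Fischer sequence with bound `A > 0`, that is, it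
satisfies the lower one of the two Riesz inequalities for finitely supported coefficients. -/
def IsRieszFischerOn (𝕜 : Type*) [RCLike 𝕜] [NormedSpace 𝕜 E] (v : ι → E) (s : Set ι) (A : ℝ) :
    Prop :=
  0 < A ∧ ∀ F : Finset ι, (F : Set ι) ⊆ s → ∀ a : ι → 𝕜,
    A * ∑ i ∈ F, ‖a i‖ ^ 2 ≤ ‖∑ i ∈ F, a i • v i‖ ^ 2

section NormedSpace

variable [NormedSpace 𝕜 E] {v : ι → E} {s : Set ι} {F : Finset ι} {A : ℝ}

theorem IsRieszFischerOn.mono {t : Set ι} (h : IsRieszFischerOn 𝕜 v t A) (hst : s ⊆ t) :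
    IsRieszFischerOn 𝕜 v s A :=
  ⟨h.1, fun F hF => h.2 F (hF.trans hst)⟩

theorem IsRieszFischerOn.mul_add_sq_le (h : IsRieszFischerOn 𝕜 v s A) {i j : ι} (hi : i ∈ s)
    (hj : j ∈ s) (hij : i ≠ j) (a b : 𝕜) :
    A * (‖a‖ ^ 2 + ‖b‖ ^ 2) ≤ ‖a • v i + b • v j‖ ^ 2 := by
  classical
  have hF : (({i, j} : Finset ι) : Set ι) ⊆ s := by simp [insert_subset_iff, hi, hj]
  simpa [Finset.sum_pair hij, hij.symm] using h.2 {i, j} hF fun k => if k = i then a else b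

theorem IsRieszFischerOn.linearIndepOn (h : IsRieszFischerOn 𝕜 v F A) :
    LinearIndepOn 𝕜 v (F : Set ι) := by
  refine linearIndepOn_finset_iff.2 fun a ha i hi => ?_
  have hle := h.2 F subset_rfl a
  rw [ha, norm_zero, zero_pow two_ne_zero] at hle
  have hsum : ∑ i ∈ F, ‖a i‖ ^ 2 = 0 :=
    (nonpos_of_mul_nonpos_right hle h.1).antisymm (Finset.sum_nonneg fun _ _ => by positivity)
  simpa using (Finset.sum_eq_zero_iff_of_nonneg fun _ _ => by positivity).1 hsum i hi

theorem IsRieszFischerOn.finrank_span (h : IsRieszFischerOn 𝕜 v F A) :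
    Module.finrank 𝕜 (Submodule.span 𝕜 (v '' F)) = F.card := by
  rw [image_eq_range]
  exact (finrank_span_eq_card h.linearIndepOn).trans (Fintype.card_coe F)

end NormedSpace

variable [InnerProductSpace 𝕜 E] {v : ι → E} {F : Finset ι} {A : ℝ}

theorem norm_sum_smul_sq_le (F : Finset ι) (v : ι → E) (a : ι → 𝕜) :
    ‖∑ i ∈ F, a i • v i‖ ^ 2 ≤ ∑ i ∈ F, ‖a i‖ * ‖inner 𝕜 (v i) (∑ j ∈ F, a j • v j)‖ := by
  calc ‖∑ i ∈ F, a i • v i‖ ^ 2 = ‖inner 𝕜 (∑ i ∈ F, a i • v i) (∑ j ∈ F, a j • v j)‖ := by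
        rw [inner_self_eq_norm_sq_to_K, norm_pow, norm_algebraMap', norm_norm]
    _ = ‖∑ i ∈ F, inner 𝕜 (a i • v i) (∑ j ∈ F, a j • v j)‖ := by rw [sum_inner]
    _ ≤ ∑ i ∈ F, ‖inner 𝕜 (a i • v i) (∑ j ∈ F, a j • v j)‖ := norm_sum_le _ _
    _ = ∑ i ∈ F, ‖a i‖ * ‖inner 𝕜 (v i) (∑ j ∈ F, a j • v j)‖ := by
        simp only [inner_smul_left, norm_mul, RCLike.norm_conj]

theorem IsRieszFischerOn.mul_norm_sq_le (h : IsRieszFischerOn 𝕜 v F A) {f : E}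
    (hf : f ∈ Submodule.span 𝕜 (v '' F)) :
    A * ‖f‖ ^ 2 ≤ ∑ i ∈ F, ‖inner 𝕜 (v i) f‖ ^ 2 := by
  obtain ⟨a, rfl⟩ := (Submodule.mem_span_image_finset_iff_exists_fun' 𝕜).1 hf
  set f := ∑ i ∈ F, a i • v i
  set S := ∑ i ∈ F, ‖inner 𝕜 (v i) f‖ ^ 2
  have hA := h.1
  have hle : ‖f‖ ^ 2 * (A * ‖f‖ ^ 2) ≤ ‖f‖ ^ 2 * S :=
    calc ‖f‖ ^ 2 * (A * ‖f‖ ^ 2) = A * (‖f‖ ^ 2) ^ 2 := by ring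
      _ ≤ A * (∑ i ∈ F, ‖a i‖ * ‖inner 𝕜 (v i) f‖) ^ 2 := by
        gcongr; exact norm_sum_smul_sq_le F v a
      _ ≤ A * ((∑ i ∈ F, ‖a i‖ ^ 2) * S) := by
        gcongr; exact Finset.sum_mul_sq_le_sq_mul_sq _ _ _
      _ = (A * ∑ i ∈ F, ‖a i‖ ^ 2) * S := by ring
      _ ≤ ‖f‖ ^ 2 * S := by gcongr; exact h.2 F subset_rfl a
  obtain h0 | h0 := (sq_nonneg ‖f‖).eq_or_lt
  · rw [← h0, mul_zero]; positivity
  · exact le_of_mul_le_mul_left hle h0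

theorem IsRieszFischerOn.mul_enorm_orthogonalProjectionOnto_sq_le (h : IsRieszFischerOn 𝕜 v F A)
    [(Submodule.span 𝕜 (v '' F)).HasOrthogonalProjection] (f : E) :
    ENNReal.ofReal A * ‖(Submodule.span 𝕜 (v '' F)).orthogonalProjectionOnto f‖ₑ ^ 2 ≤
      ∑ i ∈ F, ‖inner 𝕜 (v i) f‖ₑ ^ 2 := by
  set V := Submodule.span 𝕜 (v '' F)
  have hle : A * ‖V.orthogonalProjectionOnto f‖ ^ 2 ≤ ∑ i ∈ F, ‖inner 𝕜 (v i) f‖ ^ 2 := by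
    refine (h.mul_norm_sq_le (V.orthogonalProjectionOnto f).2).trans_eq
      (Finset.sum_congr rfl fun i hi => ?_)
    have hi : v i ∈ V := Submodule.subset_span (mem_image_of_mem v hi)
    have hinner : inner 𝕜 (v i) (V.orthogonalProjectionOnto f : E) = inner 𝕜 (v i) f :=
      Submodule.inner_orthogonalProjectionOnto_eq_of_mem_left ⟨v i, hi⟩ f
    rw [hinner]
  simpa only [ENNReal.ofReal_mul h.1.le, ENNReal.ofReal_pow (norm_nonneg _), ofReal_norm,
    ENNReal.ofReal_sum_of_nonneg fun _ _ => sq_nonneg _] using ENNReal.ofReal_le_ofReal hle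

end RieszFischer

section Separation

theorem exists_encard_le_of_pairwise {G : Type*} [Group G] [TopologicalSpace G]
    [IsTopologicalGroup G] {Q U : Set G} (hQ : IsCompact (closure Q)) (hU : U ∈ 𝓝 (1 : G)) :
    ∃ N : ℕ, ∀ Λ : Set G, (Λ.Pairwise fun s t => s⁻¹ * t ∉ U) →
      ∀ z, {t ∈ Λ | z⁻¹ * t ∈ Q}.encard ≤ N := by
  obtain ⟨V, hV, hVU⟩ := exists_nhds_split_inv hU
  obtain ⟨c, hc⟩ := compact_covered_by_mul_left_translates hQ
    ⟨1, mem_interior_iff_mem_nhds.2 (inv_mem_nhds_one G hV)⟩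
  refine ⟨c.card, fun Λ hΛ z => ?_⟩
  have hcover : ∀ t : {t ∈ Λ | z⁻¹ * t ∈ Q}, ∃ q ∈ c, q * (z⁻¹ * t) ∈ V⁻¹ := fun t => by
    simpa only [mem_iUnion₂, mem_preimage, exists_prop] using hc (subset_closure t.2.2)
  choose q hqc hqV using hcover
  have hinj : Function.Injective q := fun s t hst => by
    by_contra hne
    refine hΛ s.2.1 t.2.1 (fun h => hne (Subtype.ext h)) ?_
    simpa [hst, div_eq_mul_inv] using hVU _ (hqV s) _ (hqV t)
  rw [← encard_coe_eq_coe_finsetCard, ← ENat.card_coe_set_eq]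
  exact (ENat.card_le_card_of_injective (β := c) (f := fun t => ⟨q t, hqc t⟩) fun s t hst =>
    hinj (congrArg Subtype.val hst)).trans_eq (ENat.card_coe_set_eq _)

variable {G H : Type*} [Group G] [MeasurableSpace G] [NormedAddCommGroup H]
  [InnerProductSpace ℂ H] {π : ProjRep G H} {Λ : Set G} {g : H} {A B : ℝ}

theorem IsRieszSeq.isRieszFischerOn (h : IsRieszSeq π Λ g A B) :
    IsRieszFischerOn ℂ (fun t => π t g) Λ A := by
  classical
  refine ⟨h.1, fun F hF a => ?_⟩
  let S : Finset Λ := F.subtype (· ∈ Λ)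
  let c : lp (fun _ : Λ => ℂ) 2 := ∑ t ∈ S, lp.single 2 t (a t)
  have hc : ∀ t : Λ, c t = if t ∈ S then a t else 0 := fun t => by
    rw [lp.coeFn_sum, Finset.sum_apply]
    simp [lp.single_apply, Pi.single_apply]
  have hnorm : ‖c‖ ^ 2 = ∑ t ∈ F, ‖a t‖ ^ 2 := by
    rw [← Finset.sum_subtype_of_mem (fun t => ‖a t‖ ^ 2) hF]
    simpa using lp.norm_sum_single (p := 2) (by simp) (fun t : Λ => a t) S
  have hsum : ∑' t : Λ, c t • π (t : G) g = ∑ t ∈ F, a t • π t g := by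
    rw [← Finset.sum_subtype_of_mem (fun t => a t • π t g) hF,
      tsum_eq_sum (s := S) fun t ht => by rw [hc, if_neg ht, zero_smul]]
    exact Finset.sum_congr rfl fun t ht => by rw [hc, if_pos ht]
  rw [← hnorm, ← hsum]
  exact (h.2.2 c).2.1

theorem ProjRep.exists_nhds_one_pairwise_notMem [TopologicalSpace G] [IsTopologicalGroup G]
    [LocallyCompactSpace G] [BorelSpace G] (π : ProjRep G H) (g : H) (A : ℝ) :
    ∃ U ∈ 𝓝 (1 : G), ∀ Λ : Set G, IsRieszFischerOn ℂ (fun t => π t g) Λ A →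
      Λ.Pairwise fun s t => s⁻¹ * t ∉ U := by
  obtain hA | hA := le_or_gt A 0
  · exact ⟨univ, univ_mem, fun Λ h => absurd h.1 hA.not_gt⟩
  obtain ⟨U, hU, hθ⟩ := π.exists_nhds_one_norm_sub_smul_lt g (Real.sqrt_pos.2 hA)
  refine ⟨U, hU, fun Λ h s hs t ht hst hmem => ?_⟩
  obtain ⟨θ, hθ⟩ := hθ _ hmem
  have hlow : A * (1 + 1) ≤ ‖π (s⁻¹ * t) g - θ • g‖ ^ 2 :=
    calc A * (1 + 1) = A * (‖(π.cocycle s (s⁻¹ * t) : ℂ)‖ ^ 2 + ‖-(θ : ℂ)‖ ^ 2) := by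
          rw [norm_neg, Circle.norm_coe, Circle.norm_coe, one_pow]
      _ ≤ ‖(π.cocycle s (s⁻¹ * t) : ℂ) • π t g + -(θ : ℂ) • π s g‖ ^ 2 :=
          h.mul_add_sq_le ht hs hst.symm _ _
      _ = ‖π s (π (s⁻¹ * t) g - θ • g)‖ ^ 2 := by
          rw [map_sub, π.mul_apply, mul_inv_cancel_left, Circle.smul_def, map_smul, neg_smul,
            ← sub_eq_add_neg]
      _ = ‖π (s⁻¹ * t) g - θ • g‖ ^ 2 := by rw [(π s).norm_map]
  have hupp : ‖π (s⁻¹ * t) g - θ • g‖ ^ 2 < A := (Real.lt_sqrt (norm_nonneg _)).1 hθ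
  linarith

theorem ProjRep.exists_encard_le [TopologicalSpace G] [IsTopologicalGroup G]
    [LocallyCompactSpace G] [BorelSpace G] (π : ProjRep G H) {Q : Set G}
    (hQ : IsCompact (closure Q)) (g : H) (A : ℝ) :
    ∃ N : ℕ, ∀ Λ : Set G, IsRieszFischerOn ℂ (fun t => π t g) Λ A →
      ∀ z, {t ∈ Λ | z⁻¹ * t ∈ Q}.encard ≤ N := by
  obtain ⟨U, hU, hΛU⟩ := π.exists_nhds_one_pairwise_notMem g A
  obtain ⟨N, hN⟩ := exists_encard_le_of_pairwise hQ hU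
  exact ⟨N, fun Λ hΛ => hN Λ (hΛU Λ hΛ)⟩

end Separation

section Trace

variable {G H : Type*} [Group G] [MeasurableSpace G] [NormedAddCommGroup H]
  [InnerProductSpace ℂ H] {π : ProjRep G H} {μ : Measure G} {d : ℝ}

theorem ProjRep.enorm_orthogonalProjectionOnto_le (π : ProjRep G H) (g : H)
    (V : Submodule ℂ H) [V.HasOrthogonalProjection] (x : G) :
    ‖V.orthogonalProjectionOnto (π x g)‖ₑ ≤ ‖g‖ₑ :=
  enorm_le_iff_norm_le.2 <|
    (V.norm_orthogonalProjectionOnto_apply_le (π x g)).trans_eq ((π x).norm_map g)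

theorem IsFormalDegree.lintegral_enorm_orthogonalProjectionOnto_sq (hd : IsFormalDegree μ π d)
    (g : H) (V : Submodule ℂ H) [FiniteDimensional ℂ V] :
    ENNReal.ofReal d * ∫⁻ x, ‖V.orthogonalProjectionOnto (π x g)‖ₑ ^ 2 ∂μ =
      Module.finrank ℂ V * ‖g‖ₑ ^ 2 := by
  let b := stdOrthonormalBasis ℂ V
  have hproj : ∀ x, ‖V.orthogonalProjectionOnto (π x g)‖ₑ ^ 2 =
      ∑ i, ‖coeff π g (b i : H) x‖ₑ ^ 2 := fun x => by
    have hinner : ∀ i, ‖coeff π g (b i : H) x‖ =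
        ‖inner ℂ (b i) (V.orthogonalProjectionOnto (π x g))‖ := fun i => by
      rw [coeff, norm_inner_symm,
        ← Submodule.inner_orthogonalProjectionOnto_eq_of_mem_left (b i) (π x g),
        Submodule.coe_inner]
    simp only [← ofReal_norm, ← ENNReal.ofReal_pow (norm_nonneg _),
      ← ENNReal.ofReal_sum_of_nonneg fun _ _ => sq_nonneg _, hinner, b.sum_sq_norm_inner_right]
  have hb : ∀ i, ‖(b i : H)‖ₑ = 1 := fun i => by
    have hnorm : ‖(b i : H)‖ = 1 := b.norm_eq_one i
    rw [← ofReal_norm, hnorm, ENNReal.ofReal_one]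
  simp only [hproj]
  rw [lintegral_finsetSum _ fun i _ => (stronglyMeasurable_coeff π g _).enorm.pow_const 2,
    Finset.mul_sum]
  simp [hd.lintegral_enorm_coeff_sq, hb]

theorem IsRieszFischerOn.card_mul_enorm_sq_le (hd : IsFormalDegree μ π d) {g : H} {F : Finset G}
    {A : ℝ} (h : IsRieszFischerOn ℂ (fun t => π t g) F A) {K : Set G} (hK : MeasurableSet K) :
    F.card * ‖g‖ₑ ^ 2 ≤ ENNReal.ofReal d * (‖g‖ₑ ^ 2 * μ K +
      (ENNReal.ofReal A)⁻¹ * ∫⁻ y in Kᶜ, ∑ t ∈ F, ‖coeff π g g (y⁻¹ * t)‖ₑ ^ 2 ∂μ) := by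
  let V : Submodule ℂ H := Submodule.span ℂ ((fun t => π t g) '' F)
  have hV : FiniteDimensional ℂ V := FiniteDimensional.span_of_finite ℂ (F.finite_toSet.image _)
  have hA : ENNReal.ofReal A ≠ 0 := (ENNReal.ofReal_pos.2 h.1).ne'
  have hout : ∀ y, ‖V.orthogonalProjectionOnto (π y g)‖ₑ ^ 2 ≤
      (ENNReal.ofReal A)⁻¹ * ∑ t ∈ F, ‖coeff π g g (y⁻¹ * t)‖ₑ ^ 2 := fun y => by
    rw [← ENNReal.mul_le_iff_le_inv hA ENNReal.ofReal_ne_top]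
    refine (h.mul_enorm_orthogonalProjectionOnto_sq_le (π y g)).trans_eq
      (Finset.sum_congr rfl fun t _ => ?_)
    rw [← ofReal_norm (coeff π g g _), ← norm_coeff_apply, coeff, ofReal_norm]
  rw [← h.finrank_span, ← hd.lintegral_enorm_orthogonalProjectionOnto_sq g V,
    ← lintegral_add_compl _ hK, ← setLIntegral_const,
    ← lintegral_const_mul' _ _ (ENNReal.inv_ne_top.2 hA)]
  gcongr with y y
  · exact π.enorm_orthogonalProjectionOnto_le g V y
  · exact hout y

end Trace

section Sampling

variable {G : Type*} [Group G] [TopologicalSpace G] [IsTopologicalGroup G]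
  [MeasurableSpace G] [BorelSpace G]

theorem measure_mul_sum_enorm_sq_le (μ : Measure G) [μ.IsMulLeftInvariant] {Q : Set G}
    (hQ : Q⁻¹ = Q) {Φ : G → ℂ} (hΦ : Continuous fun x => ‖Φ x‖) {F : Finset G} {K : Set G}
    (hFK : (F : Set G) ⊆ K) {N : ℕ} (hN : ∀ z, {t ∈ (F : Set G) | z⁻¹ * t ∈ Q}.encard ≤ N) (y : G) :
    μ (interior Q) * ∑ t ∈ F, ‖Φ (y⁻¹ * t)‖ₑ ^ 2 ≤
      N * ∫⁻ z in K * Q, localMax Q Φ (y⁻¹ * z) ^ 2 ∂μ := by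
  let W : F → Set G := fun t => (t : G) • interior Q
  let M : G → ℝ≥0∞ := fun z => localMax Q Φ (y⁻¹ * z) ^ 2
  have hW : ∀ t, MeasurableSet (W t) := fun t => (isOpen_interior.smul (t : G)).measurableSet
  have hM : Measurable M :=
    ((measurable_localMax Q hΦ).comp (measurable_const_mul y⁻¹)).pow_const 2
  have hWQ : ∀ t z, z ∈ W t → z⁻¹ * t ∈ Q := by
    rintro t _ ⟨q, hq, rfl⟩
    rw [← hQ]
    simpa using interior_subset hq
  have hMge : ∀ t, ∀ z ∈ W t, ‖Φ (y⁻¹ * t)‖ₑ ^ 2 ≤ M z := fun t z hz => by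
    have := enorm_le_localMax Φ (y⁻¹ * z) (hWQ t z hz)
    rw [mul_assoc, mul_inv_cancel_left] at this
    exact pow_le_pow_left' this 2
  have hcard : ∀ z, {t | z ∈ W t}.encard ≤ N := fun z => by
    rw [← Subtype.val_injective.encard_image]
    refine (encard_le_encard ?_).trans (hN z)
    rintro _ ⟨t, ht, rfl⟩
    exact ⟨t.2, hWQ t z ht⟩
  calc μ (interior Q) * ∑ t ∈ F, ‖Φ (y⁻¹ * t)‖ₑ ^ 2
      = ∑' t : F, ∫⁻ _ in W t, ‖Φ (y⁻¹ * t)‖ₑ ^ 2 ∂μ := by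
        simp only [W, setLIntegral_const, measure_smul, ENNReal.tsum_mul_right,
          F.tsum_subtype fun t => ‖Φ (y⁻¹ * t)‖ₑ ^ 2, mul_comm]
    _ ≤ ∑' t : F, ∫⁻ z in W t, M z ∂μ :=
        ENNReal.tsum_le_tsum fun t => setLIntegral_mono hM (hMge t)
    _ = ∫⁻ z, M z ∂(Measure.sum fun t => μ.restrict (W t)) := (lintegral_sum_measure _ _).symm
    _ ≤ ∫⁻ z, M z ∂(N • μ.restrict (⋃ t, W t)) :=
        lintegral_mono' (Measure.sum_restrict_le hW hcard) le_rfl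
    _ = N * ∫⁻ z in ⋃ t, W t, M z ∂μ := by rw [lintegral_smul_measure, nsmul_eq_mul]
    _ ≤ N * ∫⁻ z in K * Q, M z ∂μ := by
        gcongr
        refine iUnion_subset fun t => ?_
        rintro _ ⟨q, hq, rfl⟩
        exact mul_mem_mul (hFK t.2) (interior_subset hq)

variable {H : Type*} [NormedAddCommGroup H] [InnerProductSpace ℂ H] (μ : Measure G)
  [μ.IsMulLeftInvariant] (π : ProjRep G H) (g : H)

theorem measure_mul_lintegral_sum_enorm_coeff_sq_le [LocallyCompactSpace G]
    {Q : Set G} (hQ : Q⁻¹ = Q) {F : Finset G} {K : Set G} (hFK : (F : Set G) ⊆ K)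
    {N : ℕ} (hN : ∀ z, {t ∈ (F : Set G) | z⁻¹ * t ∈ Q}.encard ≤ N) :
    μ (interior Q) * ∫⁻ y in Kᶜ, ∑ t ∈ F, ‖coeff π g g (y⁻¹ * t)‖ₑ ^ 2 ∂μ ≤
      N * rieszError μ π g Q K := by
  rw [rieszError, ← lintegral_const_mul' _ _ (ENNReal.natCast_ne_top N)]
  exact (lintegral_const_mul_le _ _).trans <| lintegral_mono fun y =>
    measure_mul_sum_enorm_sq_le μ hQ (continuous_norm_coeff π g g) hFK hN y

theorem rieszError_smul (Q K : Set G) (x : G) :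
    rieszError μ π g Q (x • K) = rieszError μ π g Q K := by
  have hx := measurePreserving_mul_left μ x
  have he := measurableEmbedding_mulLeft x
  have hpre : ∀ S : Set G, (x * ·) ⁻¹' (x • S) = S := fun S => by
    ext y; simp [mem_smul_set_iff_inv_smul_mem]
  rw [rieszError, rieszError, ← hx.setLIntegral_comp_preimage_emb he, ← smul_set_compl, hpre]
  refine lintegral_congr fun y => ?_
  rw [← hx.setLIntegral_comp_preimage_emb he, smul_mul_assoc, hpre]
  refine lintegral_congr fun z => ?_
  rw [mul_inv_rev, mul_assoc, inv_mul_cancel_left]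

end Sampling

section Counting

theorem encard_le_of_forall_finset {α : Type*} {s : Set α} {c : ℝ≥0∞}
    (h : ∀ F : Finset α, (F : Set α) ⊆ s → (F.card : ℝ≥0∞) ≤ c) : (s.encard : ℝ≥0∞) ≤ c := by
  rw [← ENNReal.tsum_set_one, ENNReal.tsum_eq_iSup_sum]
  refine iSup_le fun F => ?_
  simpa using h (F.map (Function.Embedding.subtype _)) (by simp)

variable {G H : Type*} [Group G] [TopologicalSpace G] [IsTopologicalGroup G]
  [LocallyCompactSpace G] [MeasurableSpace G] [BorelSpace G] [NormedAddCommGroup H]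
  [InnerProductSpace ℂ H] {π : ProjRep G H} {μ : Measure G} [μ.IsHaarMeasure] {d : ℝ} {Q : Set G}

theorem IsFormalDegree.exists_card_le (hd : IsFormalDegree μ π d)
    (hQ : IsSymmUnitNhd Q) (g : H) (A : ℝ) :
    ∃ C : ℝ, 0 < C ∧ ∀ F : Finset G, IsRieszFischerOn ℂ (fun t => π t g) F A →
      ∀ K, MeasurableSet K → (F : Set G) ⊆ K →
        F.card ≤ ENNReal.ofReal d * (μ K + ENNReal.ofReal C * rieszError μ π g Q K) := by
  obtain ⟨N, hN⟩ := π.exists_encard_le hQ.relCompact g A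
  have hμQ : μ (interior Q) ≠ 0 :=
    (isOpen_interior.measure_pos μ ⟨1, mem_interior_iff_mem_nhds.2 hQ.mem_nhds⟩).ne'
  have hμQ' : μ (interior Q) ≠ ∞ :=
    ((measure_mono (interior_subset.trans subset_closure)).trans_lt
      hQ.relCompact.measure_lt_top).ne
  set D : ℝ≥0∞ := (ENNReal.ofReal A)⁻¹ * ((μ (interior Q))⁻¹ * N)
  set C : ℝ := ((‖g‖ₑ ^ 2)⁻¹ * D).toReal
  refine ⟨max 1 C, one_pos.trans_le (le_max_left _ _), fun F h K hK hFK => ?_⟩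
  obtain rfl | ⟨t, ht⟩ := F.eq_empty_or_nonempty
  · simp
  have hg0 : ‖g‖ₑ ^ 2 ≠ 0 := fun h0 => h.linearIndepOn.ne_zero ht (by simp_all)
  have hg1 : ‖g‖ₑ ^ 2 ≠ ∞ := ENNReal.pow_ne_top enorm_ne_top
  have hA : (ENNReal.ofReal A)⁻¹ ≠ ∞ := ENNReal.inv_ne_top.2 (ENNReal.ofReal_pos.2 h.1).ne'
  have hC : (‖g‖ₑ ^ 2)⁻¹ * D ≤ ENNReal.ofReal (max 1 C) := by
    have hfin : (‖g‖ₑ ^ 2)⁻¹ * D ≠ ∞ := ENNReal.mul_ne_top (ENNReal.inv_ne_top.2 hg0) <|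
      ENNReal.mul_ne_top hA <| ENNReal.mul_ne_top (ENNReal.inv_ne_top.2 hμQ) <|
        ENNReal.natCast_ne_top N
    rw [← ENNReal.ofReal_toReal hfin]
    exact ENNReal.ofReal_le_ofReal (le_max_right _ _)
  have hsum : ∫⁻ y in Kᶜ, ∑ t ∈ F, ‖coeff π g g (y⁻¹ * t)‖ₑ ^ 2 ∂μ ≤
      (μ (interior Q))⁻¹ * (N * rieszError μ π g Q K) :=
    (ENNReal.mul_le_iff_le_inv hμQ hμQ').1 <|
      measure_mul_lintegral_sum_enorm_coeff_sq_le μ π g hQ.symm hFK (hN F h)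
  have hcard : F.card * ‖g‖ₑ ^ 2 ≤
      ENNReal.ofReal d * (‖g‖ₑ ^ 2 * μ K + D * rieszError μ π g Q K) := by
    refine (h.card_mul_enorm_sq_le hd hK).trans ?_
    simp only [D, mul_assoc]
    gcongr
  calc (F.card : ℝ≥0∞) = (‖g‖ₑ ^ 2)⁻¹ * (F.card * ‖g‖ₑ ^ 2) := by
        rw [mul_left_comm, ENNReal.inv_mul_cancel hg0 hg1, mul_one]
    _ ≤ (‖g‖ₑ ^ 2)⁻¹ * (ENNReal.ofReal d * (‖g‖ₑ ^ 2 * μ K + D * rieszError μ π g Q K)) := by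
        gcongr
    _ = ENNReal.ofReal d * (μ K + (‖g‖ₑ ^ 2)⁻¹ * D * rieszError μ π g Q K) := by
        rw [mul_left_comm, mul_add, ← mul_assoc _ (‖g‖ₑ ^ 2), ENNReal.inv_mul_cancel hg0 hg1,
          one_mul, mul_assoc _ D]
    _ ≤ ENNReal.ofReal d * (μ K + ENNReal.ofReal (max 1 C) * rieszError μ π g Q K) := by
        gcongr

theorem IsFormalDegree.exists_iSup_encard_le [T2Space G]
    (hd : IsFormalDegree μ π d) (hQ : IsSymmUnitNhd Q) (g : H) (A : ℝ) :
    ∃ C : ℝ, 0 < C ∧ ∀ Λ : Set G, IsRieszFischerOn ℂ (fun t => π t g) Λ A → ∀ K, IsCompact K →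
      ⨆ x : G, ((Λ ∩ x • K).encard : ℝ≥0∞) ≤
        ENNReal.ofReal d * (μ K + ENNReal.ofReal C * rieszError μ π g Q K) := by
  obtain ⟨C, hC, hcard⟩ := hd.exists_card_le hQ g A
  refine ⟨C, hC, fun Λ hΛ K hK => iSup_le fun x => encard_le_of_forall_finset fun F hF => ?_⟩
  rw [← measure_smul μ x K, ← rieszError_smul μ π g Q K x]
  exact hcard F (hΛ.mono (hF.trans inter_subset_left)) _ (hK.smul x).measurableSet
    (hF.trans inter_subset_right)

end Counting

end CoherentSystem

theorem theorem3p4_general {G H : Type*} [Group G] [TopologicalSpace G] [IsTopologicalGroup G]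
    [T2Space G] [LocallyCompactSpace G] [SecondCountableTopology G]
    [MeasurableSpace G] [BorelSpace G]
    (μ : Measure G) [μ.IsHaarMeasure] [μ.IsMulRightInvariant]
    [NormedAddCommGroup H] [InnerProductSpace ℂ H] [CompleteSpace H]
    (π : ProjRep G H) (hπ : IsDiscreteSeries μ π)
    (Q : Set G) (hQ : IsSymmUnitNhd Q) (g : H) (hg : g ∈ localized μ π) (A : ℝ) :
    ∃ C : ℝ, 0 < C ∧
      (∀ Λ : Set G, IsRieszFischerOn ℂ (fun t => π t g) Λ A →
        ∀ K, IsCompact K → rieszError μ π g Q K < ∞ ∧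
          ⨆ x : G, ((Λ ∩ x • K).encard : ℝ≥0∞) ≤
            ENNReal.ofReal (formalDegree μ π) *
              (μ K + ENNReal.ofReal C * rieszError μ π g Q K)) ∧
      ∀ K : ℕ → Set G, IsStrongFolner μ K →
        (fun n => (rieszError μ π g Q (K n)).toReal) =o[atTop] fun n => (μ (K n)).toReal := by
  obtain ⟨C, hC, hcard⟩ := hπ.isFormalDegree_formalDegree.exists_iSup_encard_le hQ g A
  exact ⟨C, hC, fun Λ hΛ K hK => ⟨rieszError_lt_top hQ hg hK, hcard Λ hΛ K hK⟩,
    fun K hK => hK.rieszError_isLittleO hQ hg⟩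

theorem theorem3p4 {G H : Type*} [Group G] [TopologicalSpace G] [IsTopologicalGroup G]
    [T2Space G] [LocallyCompactSpace G] [SecondCountableTopology G]
    [MeasurableSpace G] [BorelSpace G]
    (μ : Measure G) [μ.IsHaarMeasure] [μ.IsMulRightInvariant]
    [NormedAddCommGroup H] [InnerProductSpace ℂ H] [CompleteSpace H]
    [TopologicalSpace.SeparableSpace H]
    (π : ProjRep G H) (hπ : IsDiscreteSeries μ π)
    (Q : Set G) (hQ : IsSymmUnitNhd Q)
    (g : H) (hg : g ∈ localized μ π) (A B : ℝ) :
    ∃ C : ℝ, 0 < C ∧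
      ∀ Λ : Set G, IsRieszSeq π Λ g A B →
      ∀ K : ℕ → Set G, IsStrongFolnerExhaustion μ K →
        (∀ n, rieszError μ π g Q (K n) < ∞ ∧
          (⨆ x : G, ((Λ ∩ x • K n).encard : ℝ≥0∞))
            ≤ ENNReal.ofReal (formalDegree μ π) *
              (μ (K n) + ENNReal.ofReal C * rieszError μ π g Q (K n))) ∧
        (fun n => (rieszError μ π g Q (K n)).toReal) =o[atTop]
          (fun n => (μ (K n)).toReal) := by
  obtain ⟨C, hC, hcard, ho⟩ := theorem3p4_general μ π hπ Q hQ g hg A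
  exact ⟨C, hC, fun Λ hΛ K hK =>
    ⟨fun n => hcard Λ hΛ.isRieszFischerOn _ (hK.isCompact n), ho K hK.toIsStrongFolner⟩⟩
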